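/- Let $r\ge 1$ and $s\ge 0$ be integers, let $n_1,\dots,n_r,m_1,\dots,m_s$ be positive integers, and put $\eta=(n_1,\dots,n_r;m_1,\dots,m_s)$ and $n=(n_1+\dots+n_r)+2(m_1+\dots+m_s)$. Let $\mathbb{T}_m(\mathbb{R})$ be the set of lower triangular real $m\times m$ matrices all of whose diagonal entries are equal. Let $\mathbb{S}$ be the set of real matrices $\begin{bmatrix}\alpha&\beta\\-\beta&\alpha\end{bmatrix}$, and let $\mathbb{B}_m(\mathbb{R})$ be the set of real $2m\times 2m$ matrices that are block lower triangular with $m\times m$ blocks in $\mathbb{S}$ and all diagonal blocks equal. Let $$\mathcal{K}_{\eta,r,s}(\mathbb{R})=\mathbb{T}_{n_1}(\mathbb{R})\oplus\dots\oplus\mathbb{T}_{n_r}(\mathbb{R})\oplus\mathbb{B}_{m_1}(\mathbb{R})\oplus\dots\oplus\mathbb{B}_{m_s}(\mathbb{R})\subset M_n(\mathbb{R})$$ be the corresponding set of block diagonal matrices. A subsemigroup $G$ of $M_n(\mathbb{R})$ (under multiplication) is said to have normal form in $\mathcal{K}_{\eta,r,s}(\mathbb{R})$ if there is $P\in\mathrm{GL}(n,\mathbb{R})$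 with $P^{-1}GP\subset\mathcal{K}_{\eta,r,s}(\mathbb{R})$, and it is called hypercyclic if there is $v\in\mathbb{R}^n$ whose orbit $\{Av: A\in G\}$ is dense in $\mathbb{R}^n$. Then the minimum number of matrices in $M_n(\mathbb{R})$ that generate a hypercyclic abelian semigroup with normal form in $\mathcal{K}_{\eta,r,s}(\mathbb{R})$ is exactly $n-s+1$: there is a set of $n-s+1$ matrices that generates such a semigroup, and no set of fewer matrices does. -/

import Mathlib

/-- `𝕋_m(ℝ)`: lower triangular real matrices of order `m` with constant diagonal. -/
def TMat (m : ℕ) : Set (Matrix (Fin m) (Fin m) ℝ) :=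
  {M | (∀ i j, i < j → M i j = 0) ∧ ∃ μ : ℝ, ∀ i, M i i = μ}

/-- `𝕊`: the real `2 × 2` matrices `[α, β; -β, α]`. -/
def SMat : Set (Matrix (Fin 2) (Fin 2) ℝ) :=
  {C | ∃ α β : ℝ, C = !![α, β; -β, α]}

/-- `𝔹_m(ℝ)`: block lower triangular matrices of order `2m`, consisting of `m × m` blocks
in `𝕊`, with the same block at all diagonal places. The row `(i, a)` is row `a` of the `i`-th
block row. -/
def BMat (m : ℕ) : Set (Matrix (Fin m × Fin 2) (Fin m × Fin 2) ℝ) :=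
  {M | ∃ C : Matrix (Fin m) (Fin m) (Matrix (Fin 2) (Fin 2) ℝ),
    (∀ i j, C i j ∈ SMat) ∧ (∀ i j, i < j → C i j = 0) ∧ (∃ D, ∀ i, C i i = D) ∧
    M = Matrix.of fun x y => C x.1 y.1 x.2 y.2}

/-- The order-preserving numbering of the rows of a block diagonal matrix with blocks of sizes
`n_1, …, n_r, 2m_1, …, 2m_s` (in this order) by `0, …, n - 1`. -/
def blockIndex {n r s : ℕ} (nn : Fin r → ℕ) (mm : Fin s → ℕ)
    (h : ∑ k, nn k + 2 * ∑ l, mm l = n) :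
    ((Σ k : Fin r, Fin (nn k)) ⊕ (Σ l : Fin s, Fin (mm l) × Fin 2)) ≃ Fin n :=
  ((Equiv.sumCongr finSigmaFinEquiv
      ((Equiv.sigmaCongrRight fun l => finProdFinEquiv (m := mm l) (n := 2)).trans
        finSigmaFinEquiv)).trans finSumFinEquiv).trans
    (finCongr (by rw [← h, ← Finset.sum_mul, Nat.mul_comm 2]))

/-- `𝒦_{η,r,s}(ℝ) = 𝕋_{n_1}(ℝ) ⊕ ⋯ ⊕ 𝕋_{n_r}(ℝ) ⊕ 𝔹_{m_1}(ℝ) ⊕ ⋯ ⊕ 𝔹_{m_s}(ℝ)`, as a set of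
real matrices of order `n`, for `η = (n_1, …, n_r; m_1, …, m_s)`. -/
def KMat {n r s : ℕ} (nn : Fin r → ℕ) (mm : Fin s → ℕ)
    (h : ∑ k, nn k + 2 * ∑ l, mm l = n) : Set (Matrix (Fin n) (Fin n) ℝ) :=
  {M | ∃ (T : ∀ k, Matrix (Fin (nn k)) (Fin (nn k)) ℝ)
      (B : ∀ l, Matrix (Fin (mm l) × Fin 2) (Fin (mm l) × Fin 2) ℝ),
    (∀ k, T k ∈ TMat (nn k)) ∧ (∀ l, B l ∈ BMat (mm l)) ∧
    M = Matrix.reindex (blockIndex nn mm h) (blockIndex nn mm h)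
      (Matrix.fromBlocks (Matrix.blockDiagonal' T) 0 0 (Matrix.blockDiagonal' B))}

/-- `G` has a normal form in `K`: one invertible `P` satisfies `P⁻¹ G P ⊆ K`. -/
def HasNormalFormIn {n : ℕ} (G : Subsemigroup (Matrix (Fin n) (Fin n) ℝ))
    (K : Set (Matrix (Fin n) (Fin n) ℝ)) : Prop :=
  ∃ P : Matrix.GeneralLinearGroup (Fin n) ℝ, ∀ A ∈ G,
    ((P⁻¹ : Matrix.GeneralLinearGroup (Fin n) ℝ) : Matrix (Fin n) (Fin n) ℝ) * A *
      (P : Matrix (Fin n) (Fin n) ℝ) ∈ K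

/-- The semigroup `G` is abelian. -/
def IsAbelianSemigroup {n : ℕ} (G : Subsemigroup (Matrix (Fin n) (Fin n) ℝ)) : Prop :=
  ∀ A ∈ G, ∀ B ∈ G, A * B = B * A

/-- The orbit `G(v) = {A v : A ∈ G}`. -/
def semigroupOrbit {n : ℕ} (G : Subsemigroup (Matrix (Fin n) (Fin n) ℝ)) (v : Fin n → ℝ) :
    Set (Fin n → ℝ) :=
  {w | ∃ A ∈ G, w = A.mulVec v}

/-- `G` is hypercyclic: some orbit of `G` is dense in `ℝⁿ`. -/
def IsHypercyclicSemigroup {n : ℕ} (G : Subsemigroup (Matrix (Fin n) (Fin n) ℝ)) : Prop :=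
  ∃ v : Fin n → ℝ, Dense (semigroupOrbit G v)

/-! The problem reduces to a question about commutative algebras. Up to conjugation the matrices lie
in the image of `BlockAlg`, where the blocks of type 𝔹 become complex triangular matrices. Let
commuting matrices have a dense orbit at `v`, and let 𝒜 be the algebra they generate. The subspace
𝒜v is closed and dense, so it is all of ℝⁿ. By commutativity `a ↦ a v` is injective on 𝒜, so it
identifies 𝒜 with ℝⁿ (`evalEquiv`), and a dense orbit is a dense subsemigroup of 𝒜. The block
scalars ℝʳ × ℂˢ are central, hence lie in 𝒜 (`central_mem_of_cyclic`). Thus 𝒜 is ℝʳ × ℂˢ plus a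
nilpotent ideal, of total dimension n. Conversely, Toeplitz blocks give an algebra 𝒜 of this kind
with a cyclic vector (`exists_toeplitz_mulVec_eq`).

It remains to count generators of dense subsemigroups of 𝒜. Its units are dense, and logarithms turn
them into ℝⁿ⁻ˢ × {±1}ʳ × (ℝ/ℤ)ˢ: absolute values and nilpotent parts give the first factor, signs
and arguments the others.

Lower bound (`finrank_lt_card_add_of_dense`): after the arguments are forgotten, at most n - s
logarithms live in a space of dimension n - s. Some nonzero functional takes integral values on all
of them, hence on the whole semigroup, and by continuity and density on the logarithm of every unit.
This is absurd, since logarithms move along continuous curves in all directions.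

Upper bound (`exists_dense_closure`): n - s generators give the standard lattice directions, with
signs attached. One further generator has negative logarithms and generic angles. By simultaneous
approximation its powers are dense modulo the lattice and the torus, and the lattice generators,
used with nonnegative exponents, correct the rest. -/

/-! ### Exponential and logarithm of nilpotent elements. -/

section NilpotentExpLog

open Finset Polynomial

lemma eval_eq_eval_of_derivative_eq_zero {R : Type*} [CommRing R] [IsAddTorsionFree R] {p : R[X]}
    (hp : derivative p = 0) (s t : R) : p.eval s = p.eval t := by
  rw [eq_C_of_natDegree_eq_zero (derivative_eq_zero.1 hp), eval_C, eval_C]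

variable (𝕜 : Type*) {A : Type*} [Field 𝕜] [CommRing A] [Algebra 𝕜 A]

/-- The truncated exponential series `∑_{k < N} yᵏ / k!`. -/
noncomputable def nilExp (N : ℕ) (y : A) : A :=
  ∑ k ∈ range N, ((k.factorial : 𝕜)⁻¹) • y ^ k

/-- The truncated logarithmic series of `1 + y`. -/
noncomputable def nilLog (N : ℕ) (y : A) : A :=
  ∑ k ∈ range N, ((-1) ^ k * ((k : 𝕜) + 1)⁻¹) • y ^ (k + 1)

variable {𝕜}

lemma nilExp_eq_of_le {N M : ℕ} (hNM : N ≤ M) {y : A} (hy : y ^ N = 0) :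
    nilExp 𝕜 M y = nilExp 𝕜 N y := by
  refine (sum_subset (range_mono hNM) fun k _ hk => ?_).symm
  rw [pow_eq_zero_of_le (by simpa using hk) hy, smul_zero]

lemma nilLog_eq_of_le {N M : ℕ} (hNM : N ≤ M) {y : A} (hy : y ^ N = 0) :
    nilLog 𝕜 M y = nilLog 𝕜 N y := by
  refine (sum_subset (range_mono hNM) fun k _ hk => ?_).symm
  rw [pow_eq_zero_of_le (le_trans (by simpa using hk) (Nat.le_succ k)) hy, smul_zero]

lemma nilLog_eq_mul (N : ℕ) (y : A) :
    nilLog 𝕜 N y = y * ∑ k ∈ range N, ((-1) ^ k * ((k : 𝕜) + 1)⁻¹) • y ^ k := by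
  rw [nilLog, mul_sum]
  exact sum_congr rfl fun k _ => by rw [mul_smul_comm, pow_succ']

lemma nilLog_pow_eq_zero {N M : ℕ} {y : A} (hy : y ^ M = 0) : nilLog 𝕜 N y ^ M = 0 := by
  rw [nilLog_eq_mul, mul_pow, hy, zero_mul]

lemma nilLog_zero (N : ℕ) : nilLog 𝕜 N (0 : A) = 0 := by
  rw [nilLog_eq_mul, zero_mul]

lemma nilExp_zero {N : ℕ} (hN : 0 < N) : nilExp 𝕜 N (0 : A) = 1 := by
  obtain ⟨M, rfl⟩ := Nat.exists_eq_succ_of_ne_zero hN.ne'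
  simp [nilExp, sum_range_succ']

lemma eval_nilExp (N : ℕ) (t : A) (p : A[X]) :
    (nilExp 𝕜 N p).eval t = nilExp 𝕜 N (p.eval t) := by
  simp [nilExp, eval_finsetSum, eval_smul]

lemma eval_nilLog (N : ℕ) (t : A) (p : A[X]) :
    (nilLog 𝕜 N p).eval t = nilLog 𝕜 N (p.eval t) := by
  simp [nilLog, eval_finsetSum, eval_smul]

variable [CharZero 𝕜]

/-- Termwise differentiation loses one term of the sum; since `p ^ N = 0`, the lost term is zero.
This is why the truncation is at `N + 1`. -/
lemma derivative_nilExp {N : ℕ} {p : A[X]} (hp : p ^ N = 0) :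
    derivative (nilExp 𝕜 (N + 1) p) = derivative p * nilExp 𝕜 (N + 1) p := by
  conv_rhs => rw [nilExp_eq_of_le (Nat.le_succ N) hp]
  rw [nilExp, sum_range_succ', derivative_add, derivative_sum, nilExp, mul_sum]
  simp only [pow_zero, derivative_smul, derivative_one, smul_zero, add_zero]
  refine sum_congr rfl fun k _ => ?_
  rw [derivative_pow, mul_smul_comm, add_tsub_cancel_right]
  have h1 : (C ((k + 1 : ℕ) : A) : A[X]) = algebraMap 𝕜 A[X] ((k : 𝕜) + 1) := by simp
  rw [h1, mul_assoc, ← Algebra.smul_def, smul_smul, Nat.factorial_succ]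
  have h2 : (k : 𝕜) + 1 ≠ 0 := by exact_mod_cast k.succ_ne_zero
  have h3 : (((k + 1) * k.factorial : ℕ) : 𝕜)⁻¹ * ((k : 𝕜) + 1) = ((k.factorial : ℕ) : 𝕜)⁻¹ := by
    push_cast
    rw [mul_inv, mul_comm, ← mul_assoc, mul_inv_cancel₀ h2, one_mul]
  rw [h3, mul_comm (derivative p)]

lemma derivative_nilLog_mul {N : ℕ} {p : A[X]} (hp : p ^ N = 0) :
    derivative (nilLog 𝕜 N p) * (1 + p) = derivative p := by
  have h : derivative (nilLog 𝕜 N p) = derivative p * ∑ k ∈ range N, (-p) ^ k := by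
    rw [nilLog, derivative_sum, mul_sum]
    refine sum_congr rfl fun k _ => ?_
    have h1 : (C ((k + 1 : ℕ) : A) : A[X]) = algebraMap 𝕜 A[X] ((k : 𝕜) + 1) := by simp
    have h2 : (k : 𝕜) + 1 ≠ 0 := by exact_mod_cast k.succ_ne_zero
    rw [derivative_smul, derivative_pow, add_tsub_cancel_right, h1, mul_assoc,
      ← Algebra.smul_def, smul_smul, mul_assoc, inv_mul_cancel₀ h2, mul_one, neg_pow p k,
      Algebra.smul_def]
    simp only [map_pow, map_neg, map_one]
    ring
  have h3 : (∑ k ∈ range N, (-p) ^ k) * (1 + p) = 1 := by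
    have := geom_sum_mul_neg (-p) N
    rwa [sub_neg_eq_add, neg_pow, hp, mul_zero, sub_zero] at this
  rw [h, mul_assoc, h3, mul_one]

-- Replacing `a`, `b` by `aX`, `bX` makes the product a polynomial in `X` with derivative zero, so
-- its values at 1 and 0 agree. The later identities for `nilExp` and `nilLog` are obtained by the
-- same device or deduced from this one.
variable (𝕜) in
lemma nilExp_mul_nilExp_mul_nilExp_eq_one {N : ℕ} {a b : A} (ha : a ^ N = 0)
    (hb : b ^ N = 0) (hab : (a + b) ^ N = 0) :
    nilExp 𝕜 N (a + b) * nilExp 𝕜 N (-a) * nilExp 𝕜 N (-b) = 1 := by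
  have : IsAddTorsionFree A := .of_isTorsionFree 𝕜 A
  have key : ∀ c : A, c ^ N = 0 → (C c * X : A[X]) ^ N = 0 := fun c hc => by
    rw [mul_pow, ← C_pow, hc, C_0, zero_mul]
  have hneg : ∀ c : A, c ^ N = 0 → (-c) ^ N = 0 := fun c hc => by rw [neg_pow, hc, mul_zero]
  have hdX : ∀ c : A, derivative (C c * X : A[X]) = C c := fun c => by simp
  have hd : derivative (nilExp 𝕜 (N + 1) (C (a + b) * X) * nilExp 𝕜 (N + 1) (C (-a) * X) *
      nilExp 𝕜 (N + 1) (C (-b) * X)) = 0 := by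
    rw [derivative_mul, derivative_mul, derivative_nilExp (key _ hab),
      derivative_nilExp (key _ (hneg a ha)), derivative_nilExp (key _ (hneg b hb)), hdX, hdX, hdX]
    simp only [C_neg, C_add]
    ring
  have h := eval_eq_eval_of_derivative_eq_zero hd 1 0
  simp only [eval_mul, eval_nilExp, eval_C, eval_X, mul_one, mul_zero,
    nilExp_zero (Nat.succ_pos N)] at h
  rwa [nilExp_eq_of_le (Nat.le_succ N) hab, nilExp_eq_of_le (Nat.le_succ N) (hneg a ha),
    nilExp_eq_of_le (Nat.le_succ N) (hneg b hb)] at h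

variable (𝕜) in
lemma nilExp_mul_nilExp_neg {N : ℕ} (hN : 0 < N) {a : A} (ha : a ^ N = 0) :
    nilExp 𝕜 N a * nilExp 𝕜 N (-a) = 1 := by
  have h := nilExp_mul_nilExp_mul_nilExp_eq_one 𝕜 ha (b := 0) (zero_pow hN.ne') (by simpa)
  simpa [nilExp_zero hN] using h

lemma nilExp_add {N : ℕ} (hN : 0 < N) {a b : A} (ha : a ^ N = 0) (hb : b ^ N = 0)
    (hab : (a + b) ^ N = 0) :
    nilExp 𝕜 N (a + b) = nilExp 𝕜 N a * nilExp 𝕜 N b := by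
  have h1 := nilExp_mul_nilExp_neg 𝕜 hN ha
  have h2 := nilExp_mul_nilExp_neg 𝕜 hN hb
  have h3 := nilExp_mul_nilExp_mul_nilExp_eq_one 𝕜 ha hb hab
  linear_combination (-nilExp 𝕜 N (a + b)) * h1 * (nilExp 𝕜 N b * nilExp 𝕜 N (-b)) -
    nilExp 𝕜 N (a + b) * h2 + nilExp 𝕜 N a * nilExp 𝕜 N b * h3

/-- The polynomial `exp(-log(1 + aX)) (1 + aX)` has derivative zero and value 1 at 0. -/
lemma nilExp_nilLog {N : ℕ} (hN : 0 < N) {a : A} (ha : a ^ N = 0) :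
    nilExp 𝕜 N (nilLog 𝕜 N a) = 1 + a := by
  have : IsAddTorsionFree A := .of_isTorsionFree 𝕜 A
  have hX : (C a * X : A[X]) ^ N = 0 := by rw [mul_pow, ← C_pow, ha, C_0, zero_mul]
  have hL : (-nilLog 𝕜 N (C a * X : A[X])) ^ N = 0 := by
    rw [neg_pow, nilLog_pow_eq_zero hX, mul_zero]
  have hd : derivative (nilExp 𝕜 (N + 1) (-nilLog 𝕜 N (C a * X)) * (1 + C a * X)) = 0 := by
    rw [derivative_mul, derivative_nilExp hL, derivative_neg, derivative_add, derivative_one,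
      ← derivative_nilLog_mul (𝕜 := 𝕜) hX]
    ring
  have h := eval_eq_eval_of_derivative_eq_zero hd 1 0
  simp only [eval_mul, eval_nilExp, eval_neg, eval_nilLog, eval_add, eval_one, eval_C, eval_X,
    mul_one, mul_zero, nilLog_zero, neg_zero, nilExp_zero (Nat.succ_pos N), add_zero] at h
  rw [nilExp_eq_of_le (Nat.le_succ N)
    (by rw [neg_pow, nilLog_pow_eq_zero ha, mul_zero] : (-nilLog 𝕜 N a) ^ N = 0)] at h
  have h1 := nilExp_mul_nilExp_neg 𝕜 hN (nilLog_pow_eq_zero (𝕜 := 𝕜) (N := N) ha)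
  linear_combination (1 + a) * h1 - nilExp 𝕜 N (nilLog 𝕜 N a) * h

/-- This is `log((1 + a)(1 + b)) = log(1 + a) + log(1 + b)`. The difference of the two sides, with
`aX` and `bX` in place of `a` and `b`, has derivative zero: this can be checked after multiplication
by the unit `(1 + aX)(1 + bX)`. -/
lemma nilLog_add_add_mul {N : ℕ} {a b : A} (ha : a ^ N = 0) (hb : b ^ N = 0)
    (hab : (a + b + a * b) ^ N = 0) :
    nilLog 𝕜 N (a + b + a * b) = nilLog 𝕜 N a + nilLog 𝕜 N b := by
  have : IsAddTorsionFree A := .of_isTorsionFree 𝕜 A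
  have key : ∀ c : A, c ^ N = 0 → (C c * X : A[X]) ^ N = 0 := fun c hc => by
    rw [mul_pow, ← C_pow, hc, C_0, zero_mul]
  obtain ⟨p, hp⟩ : ∃ p : A[X], p = C a * X := ⟨_, rfl⟩
  obtain ⟨q, hq⟩ : ∃ q : A[X], q = C b * X := ⟨_, rfl⟩
  have hpN : p ^ N = 0 := hp ▸ key a ha
  have hqN : q ^ N = 0 := hq ▸ key b hb
  obtain ⟨M₀, hM₀⟩ : IsNilpotent (p + q + p * q) := by
    have h1 : IsNilpotent p := ⟨N, hpN⟩
    have h2 : IsNilpotent q := ⟨N, hqN⟩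
    exact ((Commute.all _ _).isNilpotent_add ((Commute.all _ _).isNilpotent_add h1 h2)
      ((Commute.all _ _).isNilpotent_mul_right h1))
  -- The hypothesis `hab` concerns only `X = 1`; over `A[X]` a larger exponent may be needed.
  obtain ⟨M, hNM, hM⟩ : ∃ M, N ≤ M ∧ (p + q + p * q) ^ M = 0 :=
    ⟨max N M₀, le_max_left _ _, pow_eq_zero_of_le (le_max_right _ _) hM₀⟩
  have hpM : p ^ M = 0 := pow_eq_zero_of_le hNM hpN
  have hqM : q ^ M = 0 := pow_eq_zero_of_le hNM hqN
  have hunit : ∀ x : A[X], x ^ M = 0 → IsUnit (1 + x) := fun x hx =>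
    IsNilpotent.isUnit_one_add ⟨M, hx⟩
  have hd : derivative (nilLog 𝕜 M (p + q + p * q) - nilLog 𝕜 M p - nilLog 𝕜 M q) = 0 := by
    refine ((hunit p hpM).mul (hunit q hqM)).mul_right_cancel ?_
    have e1 := derivative_nilLog_mul (𝕜 := 𝕜) hM
    have e2 := derivative_nilLog_mul (𝕜 := 𝕜) hpM
    have e3 := derivative_nilLog_mul (𝕜 := 𝕜) hqM
    simp only [derivative_add, derivative_mul] at e1
    simp only [derivative_sub]
    linear_combination e1 - (1 + q) * e2 - (1 + p) * e3
  have h := eval_eq_eval_of_derivative_eq_zero hd 1 0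
  simp only [eval_sub, eval_nilLog, eval_add, eval_mul, hp, hq, eval_C, eval_X, mul_one, mul_zero,
    add_zero, nilLog_zero, sub_zero, nilLog_eq_of_le hNM ha, nilLog_eq_of_le hNM hb,
    nilLog_eq_of_le hNM hab] at h
  linear_combination h

end NilpotentExpLog

/-! ### Simultaneous approximation and integral functionals. -/

/-- Simultaneous approximation: some positive vector has multiples, with arbitrarily large
factors, that are dense modulo the integer lattice. -/
lemma exists_pos_multiples_dense (ι : Type*) [Finite ι] :
    ∃ α : ι → ℝ, (∀ i, 0 < α i) ∧ ∀ (x : ι → ℝ) (ε : ℝ), 0 < ε → ∀ K : ℕ,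
      ∃ k ≥ K, ∃ m : ι → ℤ, ∀ i, |k * α i - m i - x i| < ε := by
  have := Fintype.ofFinite ι
  -- A Baire category argument: for each lower bound on `k`, rational target and precision, the good
  -- `α` form a dense open set. There are countably many conditions, and the positive orthant is
  -- open and nonempty.
  let O : ℕ × (ι → ℚ) × ℕ → Set (ι → ℝ) := fun a =>
    ⋃ k ≥ a.1, ⋃ m : ι → ℤ, {α | ∀ i, |k * α i - m i - a.2.1 i| < 1 / ((a.2.2 : ℝ) + 1)}
  have hO : ∀ a, IsOpen (O a) := by
    intro a
    refine isOpen_iUnion fun k => isOpen_iUnion fun _ => isOpen_iUnion fun m => ?_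
    rw [Set.ofPred_forall]
    exact isOpen_iInter_of_finite fun i => isOpen_lt (by fun_prop) continuous_const
  have hd : ∀ a, Dense (O a) := by
    rintro ⟨K, x, e⟩
    rw [Metric.dense_iff]
    intro α₀ ρ hρ
    obtain ⟨k₀, hk₀⟩ := exists_nat_gt (1 / ρ)
    obtain ⟨k, hkK, hk1, hkk⟩ : ∃ k : ℕ, K ≤ k ∧ 1 ≤ k ∧ k₀ ≤ k :=
      ⟨max K (max 1 k₀), le_max_left _ _, (le_max_left _ _).trans (le_max_right _ _),
        (le_max_right _ _).trans (le_max_right _ _)⟩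
    have hk : (0 : ℝ) < k := by exact_mod_cast hk1
    have hkρ : 1 < k * ρ := by
      have : (k₀ : ℝ) ≤ k := by exact_mod_cast hkk
      rw [div_lt_iff₀ hρ] at hk₀
      nlinarith
    -- The point of `(x + ℤ^ι) / k` nearest to `α₀` hits the target exactly, and its distance from
    -- `α₀` is at most `1 / (2k)` in each coordinate.
    refine ⟨fun i => (x i + round (k * α₀ i - x i)) / k, ?_, ?_⟩
    · rw [Metric.mem_ball, dist_pi_lt_iff hρ]
      intro i
      have h1 := abs_sub_round (k * α₀ i - x i)
      have h2 : (x i + round (k * α₀ i - x i)) / k - α₀ i =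
          -(k * α₀ i - x i - round (k * α₀ i - x i)) / k := by field_simp; ring
      rw [Real.dist_eq, h2, abs_div, abs_neg, abs_of_pos hk, div_lt_iff₀ hk]
      linarith
    · refine Set.mem_biUnion (x := k) hkK (Set.mem_iUnion.2 ⟨fun i => round (k * α₀ i - x i), ?_⟩)
      intro i
      have : k * ((x i + round (k * α₀ i - x i)) / k) - round (k * α₀ i - x i) - (x i : ℝ) = 0 := by
        field_simp; ring
      simp only [this, abs_zero]
      positivity
  have hpos : IsOpen {α : ι → ℝ | ∀ i, 0 < α i} := by
    rw [Set.ofPred_forall]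
    exact isOpen_iInter_of_finite fun i => isOpen_lt continuous_const (by fun_prop)
  obtain ⟨α, hα, hαO⟩ := (dense_iInter_of_isOpen hO hd).inter_open_nonempty _ hpos
    ⟨fun _ => 1, fun _ => one_pos⟩
  refine ⟨α, hα, fun x ε hε K => ?_⟩
  obtain ⟨e, he⟩ := exists_nat_one_div_lt (half_pos hε)
  have hq : ∀ i, ∃ q : ℚ, |(q : ℝ) - x i| < ε / 2 := fun i => by
    obtain ⟨q, h1, h2⟩ := exists_rat_btwn (show x i < x i + ε / 2 by linarith)
    exact ⟨q, by rw [abs_lt]; constructor <;> linarith⟩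
  choose q hq using hq
  have h := Set.mem_iInter.1 hαO (K, q, e)
  simp only [O, Set.mem_iUnion, Set.mem_ofPred_eq] at h
  obtain ⟨k, hk, m, hm⟩ := h
  refine ⟨k, hk, m, fun i => ?_⟩
  have h1 := abs_lt.1 (hm i)
  have h2 := abs_lt.1 (hq i)
  rw [abs_lt]
  constructor <;> linarith [h1.1, h1.2, h2.1, h2.2]

/-- At most `dim V` vectors of a nonzero space take integral values under some nonzero
functional. -/
lemma exists_ne_zero_functional_int {V : Type*} [AddCommGroup V] [Module ℝ V]
    [FiniteDimensional ℝ V] (hV : 0 < Module.finrank ℝ V) {κ : Type*} [Fintype κ] (v : κ → V)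
    (hκ : Fintype.card κ ≤ Module.finrank ℝ V) :
    ∃ φ : V →ₗ[ℝ] ℝ, φ ≠ 0 ∧ ∀ i, ∃ z : ℤ, φ (v i) = z := by
  classical
  -- If the vectors span, they form a basis and a coordinate function works; otherwise a functional
  -- that kills their span does.
  by_cases hsp : Submodule.span ℝ (Set.range v) = ⊤
  · have hc : Fintype.card κ = Module.finrank ℝ V :=
      le_antisymm hκ (finrank_le_of_span_eq_top hsp)
    let b := basisOfTopLeSpanOfCardEqFinrank v hsp.ge hc
    have : Nonempty κ := Fintype.card_pos_iff.1 (hc ▸ hV)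
    let i₀ : κ := Classical.arbitrary κ
    have hb : ∀ i, b i = v i := fun i => by simp [b]
    have hval : ∀ i, b.coord i₀ (v i) = if i = i₀ then 1 else 0 := fun i => by
      rw [← hb, Module.Basis.coord_apply, Module.Basis.repr_self, Finsupp.single_apply]
    refine ⟨b.coord i₀, fun h => ?_, fun i => ?_⟩
    · have := hval i₀
      simp [h] at this
    · rw [hval]
      split_ifs
      exacts [⟨1, by simp⟩, ⟨0, by simp⟩]
  · obtain ⟨φ, hφ, hle⟩ := Submodule.exists_le_ker_of_lt_top _ (lt_top_iff_ne_top.2 hsp)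
    exact ⟨φ, hφ, fun i => ⟨0, by
      simpa using hle (Submodule.subset_span (Set.mem_range_self i))⟩⟩

/-! ### The semisimple part ℝʳ × ℂˢ. -/

/-- The algebra `ℝʳ × ℂˢ`. -/
abbrev SplitAlg (r s : ℕ) : Type := (Fin r → ℝ) × (Fin s → ℂ)

/-- All coordinates are nonzero. -/
def SplitAlg.Nonvanishing {r s : ℕ} (d : SplitAlg r s) : Prop :=
  (∀ k, d.1 k ≠ 0) ∧ ∀ l, d.2 l ≠ 0

/-- The logarithms of the absolute values of the coordinates. -/
noncomputable def SplitAlg.logAbs {r s : ℕ} (d : SplitAlg r s) : SplitAlg r s :=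
  (fun k => Real.log (d.1 k), fun l => (Real.log ‖d.2 l‖ : ℂ))

namespace SplitAlg

variable {r s : ℕ}

lemma Nonvanishing.inv_mul_cancel {d : SplitAlg r s} (hd : d.Nonvanishing) : d⁻¹ * d = 1 := by
  ext i
  · simp [hd.1 i]
  · simp [hd.2 i]

lemma nonvanishing_mul_iff {d e : SplitAlg r s} :
    (d * e).Nonvanishing ↔ d.Nonvanishing ∧ e.Nonvanishing := by
  simp only [Nonvanishing, Prod.fst_mul, Prod.snd_mul, Pi.mul_apply, mul_ne_zero_iff]
  constructor
  · rintro ⟨h1, h2⟩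
    exact ⟨⟨fun k => (h1 k).1, fun l => (h2 l).1⟩, fun k => (h1 k).2, fun l => (h2 l).2⟩
  · rintro ⟨⟨h1, h2⟩, h3, h4⟩
    exact ⟨fun k => ⟨h1 k, h3 k⟩, fun l => ⟨h2 l, h4 l⟩⟩

lemma logAbs_mul {d e : SplitAlg r s} (hd : d.Nonvanishing) (he : e.Nonvanishing) :
    (d * e).logAbs = d.logAbs + e.logAbs := by
  ext i
  · simp [logAbs, Real.log_mul (hd.1 i) (he.1 i)]
  · simp [logAbs, Real.log_mul (norm_ne_zero_iff.2 (hd.2 i)) (norm_ne_zero_iff.2 (he.2 i))]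

lemma isOpen_nonvanishing : IsOpen {d : SplitAlg r s | d.Nonvanishing} := by
  have : {d : SplitAlg r s | d.Nonvanishing} =
      (⋂ k, {d : SplitAlg r s | d.1 k ≠ 0}) ∩ ⋂ l, {d : SplitAlg r s | d.2 l ≠ 0} := by
    ext d
    simp [Nonvanishing]
  rw [this]
  exact (isOpen_iInter_of_finite fun k => isOpen_ne_fun (by fun_prop) continuous_const).inter
    (isOpen_iInter_of_finite fun l => isOpen_ne_fun (by fun_prop) continuous_const)

lemma continuousOn_logAbs :
    ContinuousOn (logAbs (r := r) (s := s)) {d : SplitAlg r s | d.Nonvanishing} := by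
  refine ContinuousOn.prodMk ?_ ?_
  · refine continuousOn_pi.2 fun k => ContinuousOn.log (by fun_prop) fun d hd => hd.1 k
  · refine continuousOn_pi.2 fun l => Complex.continuous_ofReal.comp_continuousOn ?_
    exact ContinuousOn.log (by fun_prop) fun d hd => norm_ne_zero_iff.2 (hd.2 l)

lemma continuousOn_inv :
    ContinuousOn (fun d : SplitAlg r s => d⁻¹) {d : SplitAlg r s | d.Nonvanishing} := by
  refine ContinuousOn.prodMk ?_ ?_
  · refine continuousOn_pi.2 fun k => ContinuousOn.inv₀ (f := fun d : SplitAlg r s => d.1 k)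
      (by fun_prop) fun d hd => hd.1 k
  · refine continuousOn_pi.2 fun l => ContinuousOn.inv₀ (f := fun d : SplitAlg r s => d.2 l)
      (by fun_prop) fun d hd => hd.2 l

lemma finrank_eq : Module.finrank ℝ (SplitAlg r s) = r + 2 * s := by
  rw [Module.finrank_prod, Module.finrank_fintype_fun_eq_card, Module.finrank_pi_fintype]
  simp [Complex.finrank_real_complex, mul_comm]

end SplitAlg

/-! ### Logarithms of units, without arguments. -/

section LogMap

variable {A : Type*} [CommRing A] [Algebra ℝ A] {r s : ℕ}
  (ι : SplitAlg r s →ₐ[ℝ] A) (χ : A →ₐ[ℝ] SplitAlg r s)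

/-- `ν` in the decomposition `a = ι (χ a) (1 + ν)`. -/
noncomputable def nilPart (a : A) : A := ι (χ a)⁻¹ * a - 1

/-- The logarithm of `a`, up to the arguments of the coordinates of `χ a`. -/
noncomputable def logMap (N : ℕ) (a : A) : A := ι (χ a).logAbs + nilLog ℝ N (nilPart ι χ a)

variable {ι χ}

lemma map_nilPart (hιχ : ∀ d, χ (ι d) = d) {a : A} (ha : (χ a).Nonvanishing) :
    χ (nilPart ι χ a) = 0 := by
  rw [nilPart, map_sub, map_mul, hιχ, ha.inv_mul_cancel, map_one, sub_self]

/-- The factors `1 + ν` multiply. No nonvanishing is needed, because coordinatewise inversion with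
`0⁻¹ = 0` is multiplicative. -/
lemma nilPart_mul (a b : A) :
    nilPart ι χ (a * b) = nilPart ι χ a + nilPart ι χ b + nilPart ι χ a * nilPart ι χ b := by
  have : (χ (a * b))⁻¹ = (χ a)⁻¹ * (χ b)⁻¹ := by
    rw [map_mul]
    ext i <;> simp [mul_comm]
  simp only [nilPart, this]
  rw [map_mul]
  ring

lemma logMap_mul {N : ℕ} (hιχ : ∀ d, χ (ι d) = d) (hnil : ∀ x, χ x = 0 → x ^ N = 0) {a b : A}
    (ha : (χ a).Nonvanishing) (hb : (χ b).Nonvanishing) :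
    logMap ι χ N (a * b) = logMap ι χ N a + logMap ι χ N b := by
  have hab : (χ (a * b)).Nonvanishing := by
    rw [map_mul]; exact SplitAlg.nonvanishing_mul_iff.2 ⟨ha, hb⟩
  have h := hnil _ (map_nilPart hιχ hab)
  rw [nilPart_mul] at h
  rw [logMap, nilPart_mul, nilLog_add_add_mul (hnil _ (map_nilPart hιχ ha))
    (hnil _ (map_nilPart hιχ hb)) h, map_mul, SplitAlg.logAbs_mul ha hb, map_add, logMap, logMap]
  ring

variable [TopologicalSpace A] [IsTopologicalRing A] [ContinuousSMul ℝ A] [T2Space A]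
  [FiniteDimensional ℝ A]

lemma continuousOn_logMap (N : ℕ) : ContinuousOn (logMap ι χ N) {a | (χ a).Nonvanishing} := by
  have hι : Continuous ι := ι.toLinearMap.continuous_of_finiteDimensional
  have hχ : Continuous χ := χ.toLinearMap.continuous_of_finiteDimensional
  refine ContinuousOn.add ?_ ?_
  · exact hι.comp_continuousOn (SplitAlg.continuousOn_logAbs.comp hχ.continuousOn fun a ha => ha)
  · have h1 : Continuous (nilLog ℝ N : A → A) :=
      continuous_finsetSum _ fun k _ => (continuous_pow _).const_smul _
    refine h1.comp_continuousOn (ContinuousOn.sub (ContinuousOn.mul ?_ continuousOn_id)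
      continuousOn_const)
    exact hι.comp_continuousOn (SplitAlg.continuousOn_inv.comp hχ.continuousOn fun a ha => ha)

/-- A functional with integral values on the logarithms of a dense subsemigroup has integral
values on all logarithms. -/
lemma functional_logMap_int {N : ℕ} (hιχ : ∀ d, χ (ι d) = d) (hnil : ∀ x, χ x = 0 → x ^ N = 0)
    {S : Set A} (hS : Dense (Subsemigroup.closure S : Set A)) (φ : A →ₗ[ℝ] ℝ)
    (hφ : ∀ a ∈ S, ∃ z : ℤ, φ (logMap ι χ N a) = z) {a : A} (ha : (χ a).Nonvanishing) :
    ∃ z : ℤ, φ (logMap ι χ N a) = z := by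
  have hχ : Continuous χ := χ.toLinearMap.continuous_of_finiteDimensional
  have hφc : Continuous φ := φ.continuous_of_finiteDimensional
  have hU : IsOpen {a | (χ a).Nonvanishing} := SplitAlg.isOpen_nonvanishing.preimage hχ
  have hcl : ∀ a ∈ Subsemigroup.closure S, (χ a).Nonvanishing →
      ∃ z : ℤ, φ (logMap ι χ N a) = z := by
    intro a ha
    induction ha using Subsemigroup.closure_induction with
    | mem x hx => exact fun _ => hφ x hx
    | mul x y _ _ ihx ihy =>
      intro hxy
      rw [map_mul] at hxy
      obtain ⟨hx, hy⟩ := SplitAlg.nonvanishing_mul_iff.1 hxy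
      obtain ⟨z, hz⟩ := ihx hx
      obtain ⟨w, hw⟩ := ihy hy
      exact ⟨z + w, by rw [logMap_mul hιχ hnil hx hy, map_add, hz, hw]; push_cast; rfl⟩
  -- A nonintegral value at `a` persists on a nonempty open set of units, which must meet the dense
  -- semigroup.
  by_contra hcon
  have hZ : IsOpen (Set.range ((↑) : ℤ → ℝ))ᶜ := Int.isClosedEmbedding_coe_real.isClosed_range.isOpen_compl
  have hV := (hφc.comp_continuousOn (continuousOn_logMap (ι := ι) (χ := χ) N)).isOpen_inter_preimage
    hU hZ
  obtain ⟨x, ⟨hxU, hxZ⟩, hxS⟩ := hS.inter_open_nonempty _ hV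
    ⟨a, ha, fun ⟨z, hz⟩ => hcon ⟨z, hz.symm⟩⟩
  obtain ⟨z, hz⟩ := hcl x hxS hxU
  exact hxZ ⟨z, hz.symm⟩

end LogMap

/-! ### The lower bound for the number of generators. -/

/-- By the intermediate value theorem, a nonzero value would force the value `1 / 2` or `-1 / 2`. -/
lemma eq_zero_of_continuous_int {f : ℝ → ℝ} (hf : Continuous f) (h0 : f 0 = 0)
    (hint : ∀ t, ∃ z : ℤ, f t = z) (t : ℝ) : f t = 0 := by
  by_contra ht
  obtain ⟨z, hz⟩ := hint t
  have hz0 : z ≠ 0 := fun h => ht (by rw [hz, h, Int.cast_zero])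
  have key : ∀ c : ℝ, (f t ≤ c ∧ c ≤ f 0 ∨ f 0 ≤ c ∧ c ≤ f t) → ∃ w : ℤ, c = w := by
    intro c hc
    have : c ∈ Set.range f := hc.elim
      (fun h => mem_range_of_exists_le_of_exists_ge hf ⟨t, h.1⟩ ⟨0, h.2⟩)
      (fun h => mem_range_of_exists_le_of_exists_ge hf ⟨0, h.1⟩ ⟨t, h.2⟩)
    obtain ⟨u, rfl⟩ := this
    exact hint u
  rcases lt_or_gt_of_ne hz0 with h | h
  · have : (z : ℝ) ≤ -1 := by exact_mod_cast (by omega : z ≤ -1)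
    obtain ⟨w, hw⟩ := key (-1 / 2) (Or.inl ⟨by linarith, by linarith⟩)
    have h1 : (w : ℝ) < 0 := by linarith
    have h2 : (-1 : ℝ) < w := by linarith
    norm_cast at h1
    have h3 : (-1 : ℤ) < w := by exact_mod_cast h2
    omega
  · have : (1 : ℝ) ≤ z := by exact_mod_cast h
    obtain ⟨w, hw⟩ := key (1 / 2) (Or.inr ⟨by linarith, by linarith⟩)
    have h1 : (0 : ℝ) < w := by linarith
    have h2 : (w : ℝ) < 1 := by linarith
    norm_cast at h1 h2
    omega

section LowerBound

variable {A : Type*} [CommRing A] [Algebra ℝ A] {r s : ℕ}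
  {ι : SplitAlg r s →ₐ[ℝ] A} {χ : A →ₐ[ℝ] SplitAlg r s}

lemma logMap_map_exp {N : ℕ} (hιχ : ∀ d, χ (ι d) = d) (x : Fin r → ℝ) (y : Fin s → ℝ) :
    logMap ι χ N (ι (fun k => Real.exp (x k), fun l => (Real.exp (y l) : ℂ))) =
      ι (x, fun l => (y l : ℂ)) := by
  have h : SplitAlg.Nonvanishing
      ((fun k => Real.exp (x k), fun l => (Real.exp (y l) : ℂ)) : SplitAlg r s) :=
    ⟨fun k => (Real.exp_pos _).ne', fun l => by simp⟩
  rw [logMap, nilPart, hιχ, ← map_mul, h.inv_mul_cancel, map_one, sub_self, nilLog_zero, add_zero]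
  congr 1
  ext i
  · simp [SplitAlg.logAbs]
  · simp [SplitAlg.logAbs, Complex.norm_exp]

lemma logMap_one_add {N : ℕ} {ν : A} (hν : χ ν = 0) :
    logMap ι χ N (1 + ν) = nilLog ℝ N ν := by
  have h1 : ((1 : SplitAlg r s))⁻¹ = 1 := by ext <;> simp
  have h2 : (1 : SplitAlg r s).logAbs = 0 := by ext <;> simp [SplitAlg.logAbs]
  rw [logMap, nilPart, map_add, hν, map_one, add_zero, h1, h2]
  simp

/-- The elements `(0, i y)` of `ℝʳ × ℂˢ`. -/
noncomputable def SplitAlg.imag (r s : ℕ) : (Fin s → ℝ) →ₗ[ℝ] SplitAlg r s where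
  toFun y := (0, fun l => (y l : ℂ) * Complex.I)
  map_add' y z := by ext <;> simp [add_mul]
  map_smul' c y := by ext <;> simp [mul_assoc]

open Finset Polynomial in
/-- A functional that vanishes on the imaginary directions and has integral values on all
logarithms is zero. -/
lemma functional_eq_zero {N : ℕ} (hN : 0 < N) (hιχ : ∀ d, χ (ι d) = d) (φ : A →ₗ[ℝ] ℝ)
    (him : ∀ y, φ (ι (SplitAlg.imag r s y)) = 0)
    (hint : ∀ a, (χ a).Nonvanishing → ∃ z : ℤ, φ (logMap ι χ N a) = z) : φ = 0 := by
  have hre : ∀ (x : Fin r → ℝ) (y : Fin s → ℝ), φ (ι (x, fun l => (y l : ℂ))) = 0 := by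
    intro x y
    have key : ∀ t : ℝ, t * φ (ι (x, fun l => (y l : ℂ))) = 0 := by
      refine eq_zero_of_continuous_int (by fun_prop) (zero_mul _) fun t => ?_
      obtain ⟨z, hz⟩ := hint (ι (fun k => Real.exp ((t • x) k),
        fun l => (Real.exp ((t • y) l) : ℂ))) (by
          rw [hιχ]; exact ⟨fun k => (Real.exp_pos _).ne', fun l => by simp⟩)
      refine ⟨z, ?_⟩
      rw [← hz, logMap_map_exp hιχ, ← smul_eq_mul, ← map_smul, ← map_smul]
      congr 2
      ext i <;> simp
    simpa using key 1
  -- Along the curve `1 + tν` the functional is a polynomial in `t` with integral values that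
  -- vanishes at 0. It is therefore zero, and its linear coefficient is `φ ν`.
  have hker : ∀ ν : A, χ ν = 0 → φ ν = 0 := by
    intro ν hν
    obtain ⟨M, rfl⟩ := Nat.exists_eq_succ_of_ne_zero hN.ne'
    let p : ℝ[X] := ∑ k ∈ range (M + 1),
      C ((-1) ^ k * ((k : ℝ) + 1)⁻¹ * φ (ν ^ (k + 1))) * X ^ (k + 1)
    have hp : ∀ t : ℝ, p.eval t = φ (nilLog ℝ (M + 1) (t • ν)) := by
      intro t
      simp only [p, eval_finsetSum, nilLog, map_sum, map_smul, _root_.smul_pow, smul_eq_mul, eval_mul,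
        eval_C, eval_pow, eval_X]
      exact sum_congr rfl fun k _ => by ring
    have hp0 : ∀ t, p.eval t = 0 := by
      refine eq_zero_of_continuous_int p.continuous ?_ fun t => ?_
      · rw [hp, zero_smul, nilLog_zero, map_zero]
      · rw [hp]
        have hχ : χ (t • ν) = 0 := by rw [map_smul, hν, smul_zero]
        obtain ⟨z, hz⟩ := hint (1 + t • ν) (by
          rw [map_add, map_one, hχ, add_zero]
          exact ⟨fun _ => one_ne_zero, fun _ => one_ne_zero⟩)
        exact ⟨z, by rw [← hz, logMap_one_add hχ]⟩
    have hp' : p = 0 := Polynomial.funext fun t => by rw [hp0, eval_zero]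
    have hc : p.coeff 1 = φ ν := by
      simp only [p, finsetSum_coeff, coeff_C_mul, coeff_X_pow]
      rw [sum_eq_single 0]
      · simp
      · intro k _ hk
        simp [hk]
      · simp
    rw [← hc, hp', coeff_zero]
  ext a
  have h1 : χ (a - ι (χ a)) = 0 := by rw [map_sub, hιχ, sub_self]
  have h2 : χ a = ((χ a).1, fun l => (((χ a).2 l).re : ℂ)) +
      SplitAlg.imag r s (fun l => ((χ a).2 l).im) := by
    ext i
    · simp [SplitAlg.imag]
    · simp [SplitAlg.imag, Complex.re_add_im]
  have h3 := hker _ h1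
  rw [map_sub, h2, map_add, map_add, hre, him] at h3
  simpa using h3

/-- A finite set that generates a dense subsemigroup of `A` has more than `dim A - s` elements. -/
theorem finrank_lt_card_add_of_dense [TopologicalSpace A] [IsTopologicalRing A]
    [ContinuousSMul ℝ A] [T2Space A] [FiniteDimensional ℝ A] {N : ℕ} (hN : 0 < N) (hr : 0 < r)
    (hιχ : ∀ d, χ (ι d) = d) (hnil : ∀ x, χ x = 0 → x ^ N = 0) (S : Finset A)
    (hS : Dense (Subsemigroup.closure (S : Set A) : Set A)) :
    Module.finrank ℝ A < S.card + s := by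
  by_contra hcon
  rw [not_lt] at hcon
  -- The quotient by the imaginary directions, where arguments would live, has dimension `dim A -
  -- s`; it is nonzero because `r > 0`.
  let w : (Fin s → ℝ) →ₗ[ℝ] A := ι.toLinearMap ∘ₗ SplitAlg.imag r s
  have hιinj : Function.Injective ι := Function.LeftInverse.injective hιχ
  have hw : Function.Injective w := by
    refine hιinj.comp fun y z hyz => ?_
    ext l
    have := congrFun (congrArg Prod.snd hyz) l
    simpa [SplitAlg.imag] using this
  have hq : Module.finrank ℝ (A ⧸ LinearMap.range w) + s = Module.finrank ℝ A := by
    have := Submodule.finrank_quotient_add_finrank (LinearMap.range w)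
    rwa [LinearMap.finrank_range_of_inj hw, Module.finrank_fin_fun] at this
  have hA : r + 2 * s ≤ Module.finrank ℝ A := by
    rw [← SplitAlg.finrank_eq]
    exact LinearMap.finrank_le_finrank_of_injective (f := ι.toLinearMap) hιinj
  obtain ⟨ψ, hψ, hint⟩ := exists_ne_zero_functional_int (V := A ⧸ LinearMap.range w) (by omega)
    (fun a : S => (LinearMap.range w).mkQ (logMap ι χ N a)) (by
      rw [Fintype.card_coe]; omega)
  refine hψ ?_
  have h0 : ψ ∘ₗ (LinearMap.range w).mkQ = 0 := by
    refine functional_eq_zero (ι := ι) (χ := χ) hN hιχ _ (fun y => ?_) fun a ha =>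
      functional_logMap_int hιχ hnil hS _ (fun a ha => hint ⟨a, ha⟩) ha
    have : (LinearMap.range w).mkQ (ι (SplitAlg.imag r s y)) = 0 := by
      rw [Submodule.mkQ_apply, Submodule.Quotient.mk_eq_zero]
      exact ⟨y, rfl⟩
    rw [LinearMap.comp_apply, this, map_zero]
  exact LinearMap.ext fun x => by
    obtain ⟨a, rfl⟩ := Submodule.mkQ_surjective _ x
    exact LinearMap.congr_fun h0 a

end LowerBound

/-! ### The construction of a dense semigroup. -/

section UpperBound

variable {A : Type*} [CommRing A] [Algebra ℝ A] {r s d : ℕ}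
  (ι : SplitAlg r s →ₐ[ℝ] A)

/-- The parametrization of invertible elements by signs `(-1) ^ p`, angles `2πθ` and
logarithms `t`. -/
noncomputable def unitParam (N : ℕ) (b : Fin d → A) (p : Fin r → ℕ) (θ : Fin s → ℝ)
    (t : Fin r ⊕ Fin s ⊕ Fin d → ℝ) : A :=
  ι (fun k => (-1) ^ p k * Real.exp (t (.inl k)),
    fun l => Complex.exp (t (.inr (.inl l)) + θ l * (2 * Real.pi * Complex.I))) *
  nilExp ℝ N (∑ j, t (.inr (.inr j)) • b j)

variable {ι} {χ : A →ₐ[ℝ] SplitAlg r s} {N : ℕ} {b : Fin d → A}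

lemma unitParam_add (hN : 0 < N) (hnil : ∀ x, χ x = 0 → x ^ N = 0) (hb : ∀ j, χ (b j) = 0)
    (p p' : Fin r → ℕ) (θ θ' : Fin s → ℝ) (t t' : Fin r ⊕ Fin s ⊕ Fin d → ℝ) :
    unitParam ι N b (p + p') (θ + θ') (t + t') =
      unitParam ι N b p θ t * unitParam ι N b p' θ' t' := by
  have hker : ∀ c : Fin d → ℝ, (∑ j, c j • b j) ^ N = 0 := fun c => hnil _ (by simp [hb])
  have h1 : ∑ j, (t + t') (.inr (.inr j)) • b j =
      ∑ j, t (.inr (.inr j)) • b j + ∑ j, t' (.inr (.inr j)) • b j := by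
    simp [add_smul, Finset.sum_add_distrib]
  rw [unitParam, h1, nilExp_add hN (hker _) (hker _) (h1 ▸ hker _), unitParam, unitParam,
    mul_mul_mul_comm, ← map_mul]
  congr 2
  ext i
  · simp only [Pi.add_apply, pow_add, Real.exp_add, Prod.fst_mul, Pi.mul_apply]
    ring
  · simp only [Pi.add_apply, Prod.snd_mul, Pi.mul_apply, ← Complex.exp_add]
    congr 1
    push_cast
    ring

lemma unitParam_zero (hN : 0 < N) : unitParam ι N b 0 0 0 = 1 := by
  have h : ((fun _ => 1, fun _ => 1) : SplitAlg r s) = 1 := rfl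
  simp [unitParam, nilExp_zero hN, h]

/-- Only the parities of `p` and the classes of `θ` modulo 1 matter. Hence signs and angles cost no
generators beyond those for the logarithms. -/
lemma unitParam_congr {p p' : Fin r → ℕ} {θ θ' : Fin s → ℝ} (t : Fin r ⊕ Fin s ⊕ Fin d → ℝ)
    (hp : ∀ k, p k % 2 = p' k % 2) (hθ : ∀ l, ∃ z : ℤ, θ l = θ' l + z) :
    unitParam ι N b p θ t = unitParam ι N b p' θ' t := by
  rw [unitParam, unitParam]
  congr 3
  · funext k
    rw [neg_one_pow_eq_pow_mod_two, hp, ← neg_one_pow_eq_pow_mod_two]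
  · funext l
    obtain ⟨z, hz⟩ := hθ l
    rw [Complex.exp_eq_exp_iff_exists_int]
    exact ⟨z, by rw [hz]; push_cast; ring⟩

/-- Polar decomposition of the coordinates of `χ a`, combined with `exp ∘ log` on the unipotent
factor. -/
lemma exists_eq_unitParam (hN : 0 < N) (hιχ : ∀ d, χ (ι d) = d)
    (hnil : ∀ x, χ x = 0 → x ^ N = 0)
    (hspan : ∀ x, χ x = 0 → ∃ c : Fin d → ℝ, x = ∑ j, c j • b j) {a : A}
    (ha : (χ a).Nonvanishing) : ∃ p θ t, a = unitParam ι N b p θ t := by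
  have hy := map_nilPart hιχ ha
  obtain ⟨c, hc⟩ := hspan (nilLog ℝ N (nilPart ι χ a)) (by
    rw [nilLog_eq_mul, map_mul, hy, zero_mul])
  refine ⟨fun k => if (χ a).1 k < 0 then 1 else 0,
    fun l => ((χ a).2 l).arg / (2 * Real.pi),
    Sum.elim (fun k => Real.log ((χ a).1 k)) (Sum.elim (fun l => Real.log ‖(χ a).2 l‖) c), ?_⟩
  rw [unitParam]
  simp only [Sum.elim_inl, Sum.elim_inr]
  rw [← hc, nilExp_nilLog hN (hnil _ hy)]
  have h1 : ((fun k => (-1) ^ (if (χ a).1 k < 0 then 1 else 0) * Real.exp (Real.log ((χ a).1 k)),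
      fun l => Complex.exp (Real.log ‖(χ a).2 l‖ +
        (((χ a).2 l).arg / (2 * Real.pi) : ℝ) * (2 * Real.pi * Complex.I))) : SplitAlg r s) =
      χ a := by
    ext i
    · simp only
      rw [Real.exp_log_eq_abs (ha.1 i)]
      split_ifs with h
      · rw [abs_of_neg h]; ring
      · rw [abs_of_nonneg (not_lt.1 h)]; ring
    · simp only
      have h2 : (((χ a).2 i).arg / (2 * Real.pi) : ℝ) * (2 * Real.pi * Complex.I) =
          ((χ a).2 i).arg * Complex.I := by
        have : (Real.pi : ℂ) ≠ 0 := by exact_mod_cast Real.pi_ne_zero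
        push_cast
        field_simp
      rw [h2, Complex.exp_add, ← Complex.ofReal_exp, Real.exp_log (norm_pos_iff.2 (ha.2 i))]
      exact Complex.norm_mul_exp_arg_mul_I _
  rw [h1, nilPart, add_sub_cancel, ← mul_assoc, ← map_mul, mul_comm (χ a), ha.inv_mul_cancel,
    map_one, one_mul]

/-- A subsemigroup need not contain 1. The factor `x` allows zero exponents, so the admissible `u`
form an additive submonoid containing the standard basis. -/
lemma mul_unitParam_mem (hN : 0 < N) (hnil : ∀ x, χ x = 0 → x ^ N = 0)
    (hb : ∀ j, χ (b j) = 0) {C : Subsemigroup A}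
    (hC : ∀ i : Fin r ⊕ Fin s ⊕ Fin d, unitParam ι N b
      (fun k => (Pi.single i 1 : _ → ℕ) (.inl k)) 0 (fun j => (Pi.single i 1 : _ → ℕ) j) ∈ C)
    (u : Fin r ⊕ Fin s ⊕ Fin d → ℕ) {x : A} (hx : x ∈ C) :
    x * unitParam ι N b (fun k => u (.inl k)) 0 (fun j => u j) ∈ C := by
  let M : AddSubmonoid (Fin r ⊕ Fin s ⊕ Fin d → ℕ) :=
    { carrier := {u | ∀ x ∈ C, x * unitParam ι N b (fun k => u (.inl k)) 0 (fun j => u j) ∈ C}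
      zero_mem' := fun x hx => by
        have h := unitParam_zero (ι := ι) (b := b) hN
        simp only [Pi.zero_apply, Nat.cast_zero]
        change x * unitParam ι N b 0 0 0 ∈ C
        rwa [h, mul_one]
      add_mem' := fun {u v} hu hv x hx => by
        have h := unitParam_add (ι := ι) hN hnil hb (fun k => u (.inl k)) (fun k => v (.inl k)) 0 0
          (fun j => u j) (fun j => v j)
        have h2 : (fun j => ((u + v) j : ℝ)) = (fun j => (u j : ℝ)) + fun j => (v j : ℝ) := by
          funext j; simp
        have h3 : (fun k => (u + v) (.inl k)) = (fun k => u (.inl k)) + fun k => v (.inl k) := rfl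
        rw [h2, h3, ← add_zero (0 : Fin s → ℝ), h, ← mul_assoc]
        exact hv _ (hu x hx) }
  have hu : u ∈ M := by
    have : u = ∑ i, u i • (Pi.single i 1 : _ → ℕ) := by
      rw [← Finset.univ_sum_single u]
      refine Finset.sum_congr rfl fun i _ => ?_
      simp [← Pi.single_smul]
    rw [this]
    exact sum_mem fun i _ => nsmul_mem (show _ ∈ M from fun x hx => C.mul_mem hx (hC i)) _
  exact hu x hx

variable [TopologicalSpace A] [IsTopologicalRing A] [ContinuousSMul ℝ A]

lemma continuous_unitParam (p : Fin r → ℕ) :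
    Continuous fun x : (Fin s → ℝ) × (Fin r ⊕ Fin s ⊕ Fin d → ℝ) =>
      unitParam ι N b p x.1 x.2 := by
  have hι : Continuous ι := ι.toLinearMap.continuous_of_finiteDimensional
  have h1 : Continuous (nilExp ℝ N : A → A) :=
    continuous_finsetSum _ fun k _ => (continuous_pow _).const_smul _
  exact (hι.comp (by fun_prop)).mul (h1.comp (by fun_prop))

/-- Adding a real scalar `t` to `a` makes all coordinates nonzero for all but finitely many `t`. -/
lemma dense_nonvanishing : Dense {a : A | (χ a).Nonvanishing} := by
  intro a
  let bad : Set ℝ := Set.range (fun k => -(χ a).1 k) ∪ Set.range (fun l => -((χ a).2 l).re)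
  have hbad : bad.Finite := (Set.finite_range _).union (Set.finite_range _)
  have hc : Continuous fun t : ℝ => a + t • (1 : A) := by fun_prop
  have h := map_mem_closure hc (hbad.countable.dense_compl ℝ 0) (t := {a : A | (χ a).Nonvanishing}) ?_
  · simpa using h
  · intro t ht
    simp only [bad, Set.mem_compl_iff, Set.mem_union, not_or, Set.mem_range, not_exists] at ht
    refine ⟨fun k h => ht.1 k ?_, fun l h => ht.2 l ?_⟩
    · simp at h
      linarith
    · have := congrArg Complex.re h
      simp at this
      linarith

/-- Some finite set of at most `dim A - s + 1` elements generates a dense subsemigroup of `A`. -/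
theorem exists_dense_closure [FiniteDimensional ℝ A] (hN : 0 < N) (hιχ : ∀ d, χ (ι d) = d)
    (hnil : ∀ x, χ x = 0 → x ^ N = 0) :
    ∃ S : Finset A, S.card + s ≤ Module.finrank ℝ A + 1 ∧
      Dense (Subsemigroup.closure (S : Set A) : Set A) := by
  classical
  obtain ⟨d, hd⟩ : ∃ d, d = Module.finrank ℝ (LinearMap.ker χ.toLinearMap) := ⟨_, rfl⟩
  have hdim : Module.finrank ℝ A = r + 2 * s + d := by
    have h1 := LinearMap.finrank_range_add_finrank_ker χ.toLinearMap
    have h2 : LinearMap.range χ.toLinearMap = ⊤ :=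
      LinearMap.range_eq_top.2 fun x => ⟨ι x, hιχ x⟩
    rw [h2, finrank_top, SplitAlg.finrank_eq] at h1
    omega
  let bas := Module.finBasisOfFinrankEq ℝ (LinearMap.ker χ.toLinearMap) hd.symm
  let b : Fin d → A := fun j => bas j
  have hb : ∀ j, χ (b j) = 0 := fun j => (bas j).2
  have hspan : ∀ x, χ x = 0 → ∃ c : Fin d → ℝ, x = ∑ j, c j • b j := fun x hx => by
    refine ⟨fun j => bas.repr ⟨x, hx⟩ j, ?_⟩
    have := congrArg Subtype.val (bas.sum_repr ⟨x, hx⟩)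
    rw [AddSubmonoidClass.coe_finsetSum] at this
    exact this.symm
  obtain ⟨α, hα, hkron⟩ := exists_pos_multiples_dense ((Fin r ⊕ Fin s ⊕ Fin d) ⊕ Fin s)
  let g : Fin r ⊕ Fin s ⊕ Fin d → A := fun i => unitParam ι N b
      (fun k => (Pi.single i 1 : _ → ℕ) (.inl k)) 0 (fun j => (Pi.single i 1 : _ → ℕ) j)
  -- `g₀ k` is the `k`-th power of `g₀ 1`. The factor 2 leaves the parity of the lattice exponents
  -- free, so that signs can be prescribed; the minus sign makes those exponents positive for large
  -- `k`.
  let g₀ : ℕ → A := fun k => unitParam ι N b 0 (fun l => k * α (.inr l))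
    (fun i => -(k * (2 * α (.inl i))))
  refine ⟨insert (g₀ 1) (Finset.univ.image g), ?_, ?_⟩
  · have h1 := Finset.card_insert_le (g₀ 1) (Finset.univ.image g)
    have h2 := Finset.card_image_le (s := Finset.univ) (f := g)
    simp only [Finset.card_univ, Fintype.card_sum, Fintype.card_fin] at h2
    omega
  · set C := Subsemigroup.closure ((insert (g₀ 1) (Finset.univ.image g) : Finset A) : Set A)
    have hg : ∀ i, g i ∈ C := fun i => Subsemigroup.subset_closure (by simp)
    have hg₀ : ∀ k, 1 ≤ k → g₀ k ∈ C := by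
      intro k hk
      induction k, hk using Nat.le_induction with
      | base => exact Subsemigroup.subset_closure (by simp)
      | succ k _ ih =>
        have h : g₀ (k + 1) = g₀ k * g₀ 1 := by
          simp only [g₀]
          rw [← unitParam_add hN hnil hb]
          congr 1
          · funext l; simp; ring
          · funext i; simp; ring
        rw [h]
        exact C.mul_mem ih (Subsemigroup.subset_closure (by simp))
    refine ((dense_nonvanishing (χ := χ)).mono fun a ha => ?_).of_closure
    obtain ⟨p, θ, t, rfl⟩ := exists_eq_unitParam hN hιχ hnil hspan ha
    rw [mem_closure_iff]
    intro U hU haU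
    obtain ⟨δ, hδ, hball⟩ := Metric.isOpen_iff.1
      (hU.preimage (continuous_unitParam (ι := ι) (N := N) (b := b) p)) (θ, t) haU
    obtain ⟨K, hK1, hK⟩ : ∃ K : ℕ, 1 ≤ K ∧ ∀ k ≥ K, ∀ i, |t i| + δ ≤ 2 * (k * α (.inl i)) := by
      have h : ∀ᶠ k : ℕ in Filter.atTop, ∀ i, |t i| + δ ≤ 2 * (k * α (.inl i)) := by
        refine Filter.eventually_all.2 fun i => ?_
        have := (tendsto_natCast_atTop_atTop (R := ℝ)).atTop_mul_const (hα (.inl i))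
        exact (this.const_mul_atTop two_pos).eventually_ge_atTop _
      obtain ⟨K, hK⟩ := Filter.eventually_atTop.1 h
      exact ⟨max K 1, le_max_right _ _, fun k hk => hK k ((le_max_left _ _).trans hk)⟩
    -- `q` prescribes the parities. With exponents `u = 2m + q` the logarithms become `2m + q -
    -- 2kα`, so approximating `(q - t) / 2` by `kα - m` within `δ / 2` brings them within `δ` of
    -- `t`.
    let q : Fin r ⊕ Fin s ⊕ Fin d → ℕ := Sum.elim p 0
    obtain ⟨k, hk, m, hm⟩ := hkron (Sum.elim (fun i => (q i - t i) / 2) θ) (δ / 2) (half_pos hδ) K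
    let u : Fin r ⊕ Fin s ⊕ Fin d → ℕ := fun i => (2 * m (.inl i) + q i).toNat
    have hmi : ∀ i, |(2 * m (.inl i) + q i : ℝ) - 2 * (k * α (.inl i)) - t i| < δ := fun i => by
      have := abs_lt.1 (hm (.inl i))
      simp only [Sum.elim_inl] at this
      rw [abs_lt]
      constructor <;> linarith [this.1, this.2]
    -- The choice of `K` makes `2m + q` nonnegative, so `toNat` changes nothing.
    have hu : ∀ i, (u i : ℤ) = 2 * m (.inl i) + q i := fun i => by
      refine Int.toNat_of_nonneg ?_
      have h1 := (abs_lt.1 (hmi i)).1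
      have h2 := hK k hk i
      have h3 := neg_abs_le (t i)
      have h4 : (0 : ℝ) ≤ 2 * m (.inl i) + q i := by linarith
      exact_mod_cast h4
    have huR : ∀ i, (u i : ℝ) = 2 * m (.inl i) + q i := fun i => by exact_mod_cast hu i
    have hmem := mul_unitParam_mem hN hnil hb hg u (hg₀ k (hK1.trans hk))
    rw [← unitParam_add hN hnil hb, unitParam_congr (p' := p)
      (θ' := fun l => k * α (.inr l) - m (.inr l)) _ (fun k => ?_)
      fun l => ⟨m (.inr l), by simp⟩] at hmem
    · refine ⟨_, ?_, hmem⟩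
      refine hball (show (_, _) ∈ _ from ?_)
      rw [Metric.mem_ball, Prod.dist_eq, max_lt_iff, dist_pi_lt_iff hδ, dist_pi_lt_iff hδ]
      refine ⟨fun l => ?_, fun i => ?_⟩
      · rw [Real.dist_eq]
        exact (hm (.inr l)).trans (half_lt_self hδ)
      · have h := hmi i
        rw [← huR] at h
        rw [Real.dist_eq]
        convert h using 2
        simp only [Pi.add_apply]
        ring
    · have := hu (.inl k)
      simp only [q, Sum.elim_inl] at this
      simp only [Pi.add_apply, Pi.zero_apply, zero_add]
      omega

end UpperBound

/-! ### Triangular matrices with constant diagonal. -/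

section TriAlgebra

variable (𝕜 : Type*) [Field 𝕜]

/-- Lower triangular matrices with constant diagonal. -/
def triAlgebra (m : ℕ) : Subalgebra 𝕜 (Matrix (Fin m) (Fin m) 𝕜) where
  carrier := {M | (∀ i j, i < j → M i j = 0) ∧ ∀ i j, M i i = M j j}
  mul_mem' := by
    rintro M N ⟨hM, hM'⟩ ⟨hN, hN'⟩
    have hd : ∀ i, (M * N) i i = M i i * N i i := fun i => by
      rw [Matrix.mul_apply, Finset.sum_eq_single i]
      · intro k _ hk
        rcases lt_or_gt_of_ne hk with h | h
        · rw [hN k i h, mul_zero]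
        · rw [hM i k h, zero_mul]
      · simp
    refine ⟨fun i j hij => ?_, fun i j => by rw [hd, hd, hM' i j, hN' i j]⟩
    rw [Matrix.mul_apply]
    refine Finset.sum_eq_zero fun k _ => ?_
    rcases lt_or_ge i k with h | h
    · rw [hM i k h, zero_mul]
    · rw [hN k j (h.trans_lt hij), mul_zero]
  add_mem' := by
    rintro M N ⟨hM, hM'⟩ ⟨hN, hN'⟩
    exact ⟨fun i j hij => by simp [hM i j hij, hN i j hij], fun i j => by
      simp [hM' i j, hN' i j]⟩
  algebraMap_mem' c :=
    ⟨fun i j hij => by simp [Matrix.algebraMap_matrix_apply, hij.ne], fun i j => by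
      simp [Matrix.algebraMap_matrix_apply]⟩

variable {𝕜} {m : ℕ}

lemma triAlgebra_mul_apply_diag (M N : triAlgebra 𝕜 m) (i : Fin m) :
    (M * N).1 i i = M.1 i i * N.1 i i := by
  change (M.1 * N.1) i i = _
  rw [Matrix.mul_apply, Finset.sum_eq_single i]
  · intro k _ hk
    rcases lt_or_gt_of_ne hk with h | h
    · rw [N.2.1 k i h, mul_zero]
    · rw [M.2.1 i k h, zero_mul]
  · simp

/-- The diagonal entry of a lower triangular matrix with constant diagonal. -/
def triDiag (hm : 0 < m) : triAlgebra 𝕜 m →ₐ[𝕜] 𝕜 where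
  toFun M := M.1 ⟨0, hm⟩ ⟨0, hm⟩
  map_one' := by simp
  map_mul' M N := triAlgebra_mul_apply_diag M N _
  map_zero' := rfl
  map_add' _ _ := rfl
  commutes' c := by simp [Matrix.algebraMap_matrix_apply]

lemma triAlgebra_pow_eq_zero (hm : 0 < m) {M : triAlgebra 𝕜 m} (hM : triDiag hm M = 0) :
    M ^ m = 0 := by
  have hM0 : ∀ i j : Fin m, (i : ℕ) < j + 1 → M.1 i j = 0 := by
    intro i j hij
    rcases Nat.lt_succ_iff_lt_or_eq.1 hij with h | h
    · exact M.2.1 i j h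
    · obtain rfl := Fin.ext h
      rw [M.2.2 i ⟨0, hm⟩]
      exact hM
  -- Each factor moves the support down by one more subdiagonal.
  have key : ∀ k : ℕ, ∀ i j : Fin m, (i : ℕ) < j + k → (M ^ k).1 i j = 0 := by
    intro k
    induction k with
    | zero =>
      intro i j hij
      rw [pow_zero]
      exact Matrix.one_apply_ne fun h => by simp [h] at hij
    | succ k ih =>
      intro i j hij
      rw [pow_succ]
      change ((M ^ k).1 * M.1) i j = 0
      rw [Matrix.mul_apply]
      refine Finset.sum_eq_zero fun l _ => ?_
      rcases lt_or_ge (i : ℕ) (l + k) with h | h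
      · rw [ih i l h, zero_mul]
      · rw [hM0 l j (by omega), mul_zero]
  ext i j
  exact key m i j (by omega)

variable (𝕜 m) in
/-- The nilpotent Jordan block, as an element of the triangular algebra. -/
def triShift : triAlgebra 𝕜 m :=
  ⟨Matrix.of fun i j => if (i : ℕ) = j + 1 then 1 else 0, fun i j hij => by
    have : (i : ℕ) < j := hij
    rw [Matrix.of_apply, if_neg (by omega)], fun i j => by simp⟩

lemma triShift_pow_apply_zero (hm : 0 < m) (j : ℕ) (i : Fin m) :
    (triShift 𝕜 m ^ j).1 i ⟨0, hm⟩ = if (i : ℕ) = j then 1 else 0 := by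
  induction j generalizing i with
  | zero =>
    rw [pow_zero]
    change (1 : Matrix (Fin m) (Fin m) 𝕜) i ⟨0, hm⟩ = _
    rw [Matrix.one_apply]
    simp [Fin.ext_iff]
  | succ j ih =>
    rw [pow_succ']
    change ((triShift 𝕜 m).1 * (triShift 𝕜 m ^ j).1) i ⟨0, hm⟩ = _
    rw [Matrix.mul_apply]
    simp only [ih]
    split_ifs with h
    · rw [Finset.sum_eq_single ⟨j, by omega⟩]
      · simp [triShift, h]
      · intro k _ hk
        rw [if_neg fun h' => hk (Fin.ext h'), mul_zero]
      · simp
    · refine Finset.sum_eq_zero fun k _ => ?_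
      split_ifs with h'
      · simp [triShift, h', h]
      · rw [mul_zero]

/-- The powers of the shift have the standard basis vectors as first columns, so the first basis
vector is cyclic. -/
lemma exists_mem_adjoin_triShift (hm : 0 < m) (w : Fin m → 𝕜) :
    ∃ a ∈ Algebra.adjoin 𝕜 {triShift 𝕜 m}, ∀ i, a.1 i ⟨0, hm⟩ = w i := by
  refine ⟨∑ j : Fin m, w j • triShift 𝕜 m ^ (j : ℕ), sum_mem fun j _ =>
    Subalgebra.smul_mem _ (pow_mem (Algebra.self_mem_adjoin_singleton _ _) _) _, fun i => ?_⟩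
  rw [AddSubmonoidClass.coe_finsetSum, Matrix.sum_apply]
  simp only [Subalgebra.coe_smul, Matrix.smul_apply, triShift_pow_apply_zero, smul_eq_mul]
  rw [Finset.sum_eq_single i]
  · simp
  · intro j _ hj
    rw [if_neg fun h => hj (Fin.ext h.symm), mul_zero]
  · simp

end TriAlgebra

/-! ### The block algebra and its real matrix representation. -/

section BlockAlgebra

variable {r s : ℕ} (nn : Fin r → ℕ) (mm : Fin s → ℕ)

/-- The product of triangular algebras with real blocks of sizes `nn` and complex blocks of
sizes `mm`. -/
abbrev BlockAlg : Type := (∀ k, triAlgebra ℝ (nn k)) × (∀ l, triAlgebra ℂ (mm l))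

/-- Block scalar elements. -/
noncomputable def blockScalar : SplitAlg r s →ₐ[ℝ] BlockAlg nn mm where
  toFun d := (fun k => algebraMap ℝ _ (d.1 k), fun l => algebraMap ℂ _ (d.2 l))
  map_one' := by ext <;> simp
  map_mul' d e := by ext <;> simp
  map_zero' := by ext <;> simp
  map_add' d e := by ext <;> simp
  commutes' c := by
    refine Prod.ext rfl (funext fun l => ?_)
    exact (IsScalarTower.algebraMap_apply ℝ ℂ (triAlgebra ℂ (mm l)) c).symm

variable {nn mm}

lemma blockScalar_comm (d : SplitAlg r s) (q : BlockAlg nn mm) :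
    blockScalar nn mm d * q = q * blockScalar nn mm d :=
  Prod.ext (funext fun _ => Algebra.commutes _ _) (funext fun _ => Algebra.commutes _ _)

/-- The diagonal entries of all blocks. -/
noncomputable def blockDiag (hnn : ∀ k, 0 < nn k) (hmm : ∀ l, 0 < mm l) :
    BlockAlg nn mm →ₐ[ℝ] SplitAlg r s where
  toFun q := (fun k => triDiag (hnn k) (q.1 k), fun l => triDiag (hmm l) (q.2 l))
  map_one' := by ext <;> simp
  map_mul' d e := by ext <;> simp
  map_zero' := by ext <;> simp
  map_add' d e := by ext <;> simp
  commutes' c := by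
    refine Prod.ext (funext fun k => ?_) (funext fun l => ?_)
    · exact (triDiag (hnn k)).commutes c
    · change triDiag (hmm l) (algebraMap ℝ (triAlgebra ℂ (mm l)) c) = (c : ℂ)
      rw [IsScalarTower.algebraMap_apply ℝ ℂ (triAlgebra ℂ (mm l)) c]
      exact (triDiag (hmm l)).commutes (c : ℂ)

lemma blockDiag_blockScalar (hnn : ∀ k, 0 < nn k) (hmm : ∀ l, 0 < mm l) (d : SplitAlg r s) :
    blockDiag hnn hmm (blockScalar nn mm d) = d :=
  Prod.ext (funext fun k => (triDiag (hnn k)).commutes _)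
    (funext fun l => (triDiag (hmm l)).commutes _)

lemma blockAlg_pow_eq_zero (hnn : ∀ k, 0 < nn k) (hmm : ∀ l, 0 < mm l) {q : BlockAlg nn mm}
    (hq : blockDiag hnn hmm q = 0) : q ^ (∑ k, nn k + ∑ l, mm l + 1) = 0 := by
  refine Prod.ext (funext fun k => ?_) (funext fun l => ?_)
  · refine pow_eq_zero_of_le (m := nn k) ?_
      (triAlgebra_pow_eq_zero (hnn k) (congrFun (congrArg Prod.fst hq) k))
    have := Finset.single_le_sum (f := nn) (fun _ _ => Nat.zero_le _) (Finset.mem_univ k)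
    omega
  · refine pow_eq_zero_of_le (m := mm l) ?_
      (triAlgebra_pow_eq_zero (hmm l) (congrFun (congrArg Prod.snd hq) l))
    have := Finset.single_le_sum (f := mm) (fun _ _ => Nat.zero_le _) (Finset.mem_univ l)
    omega

/-- The action of the complex matrices on `ℝ²ᵐ`. -/
noncomputable def complexToReal (m : ℕ) :
    Matrix (Fin m) (Fin m) ℂ →ₐ[ℝ] Matrix (Fin m × Fin 2) (Fin m × Fin 2) ℝ :=
  ((Matrix.compAlgEquiv (Fin m) (Fin 2) ℝ ℝ).toAlgHom).comp
    (Algebra.leftMulMatrix Complex.basisOneI).mapMatrix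

lemma complexToReal_apply {m : ℕ} (M : Matrix (Fin m) (Fin m) ℂ) (x y : Fin m × Fin 2) :
    complexToReal m M x y = Algebra.leftMulMatrix Complex.basisOneI (M x.1 y.1) x.2 y.2 := rfl

lemma complexToReal_injective (m : ℕ) : Function.Injective (complexToReal m) := by
  intro M N h
  ext i j : 2
  refine Algebra.leftMulMatrix_injective Complex.basisOneI ?_
  ext a b
  exact congrFun (congrFun h (i, a)) (j, b)

variable (nn mm) in
/-- The block diagonal matrix of an element of the block algebra. -/
noncomputable def blockMatrix : BlockAlg nn mm →ₐ[ℝ]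
    Matrix ((Σ k, Fin (nn k)) ⊕ (Σ l, Fin (mm l) × Fin 2))
      ((Σ k, Fin (nn k)) ⊕ (Σ l, Fin (mm l) × Fin 2)) ℝ :=
  AlgHom.ofLinearMap
    { toFun := fun q => Matrix.fromBlocks (Matrix.blockDiagonal' fun k => (q.1 k).1) 0 0
        (Matrix.blockDiagonal' fun l => complexToReal (mm l) (q.2 l).1)
      map_add' := fun q q' => by
        have h : (fun l => complexToReal (mm l) ((q + q').2 l).1) =
            (fun l => complexToReal (mm l) (q.2 l).1) + fun l => complexToReal (mm l) (q'.2 l).1 :=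
          funext fun l => map_add (complexToReal (mm l)) _ _
        rw [Matrix.fromBlocks_add, ← Matrix.blockDiagonal'_add, ← Matrix.blockDiagonal'_add,
          add_zero, add_zero, h]
        rfl
      map_smul' := fun c q => by
        have h : (fun l => complexToReal (mm l) ((c • q).2 l).1) =
            c • fun l => complexToReal (mm l) (q.2 l).1 :=
          funext fun l => map_smul (complexToReal (mm l)) _ _
        rw [RingHom.id_apply, Matrix.fromBlocks_smul, ← Matrix.blockDiagonal'_smul,
          ← Matrix.blockDiagonal'_smul, smul_zero, smul_zero, h]
        rfl }
    (by
      have h1 : (fun k => ((1 : BlockAlg nn mm).1 k).1) = 1 := rfl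
      have h2 : (fun l => complexToReal (mm l) ((1 : BlockAlg nn mm).2 l).1) = 1 :=
        funext fun l => map_one (complexToReal (mm l))
      simp only [LinearMap.coe_mk, AddHom.coe_mk]
      rw [h1, h2, Matrix.blockDiagonal'_one, Matrix.blockDiagonal'_one, Matrix.fromBlocks_one])
    (fun q q' => by
      simp only [LinearMap.coe_mk, AddHom.coe_mk]
      have h : (fun l => complexToReal (mm l) ((q * q').2 l).1) =
          fun l => complexToReal (mm l) (q.2 l).1 * complexToReal (mm l) (q'.2 l).1 :=
        funext fun l => map_mul (complexToReal (mm l)) _ _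
      rw [Matrix.fromBlocks_multiply, h, Matrix.blockDiagonal'_mul]
      simp only [Matrix.mul_zero, Matrix.zero_mul, add_zero, zero_add,
        ← Matrix.blockDiagonal'_mul]
      rfl)

lemma blockMatrix_apply (q : BlockAlg nn mm) :
    blockMatrix nn mm q = Matrix.fromBlocks (Matrix.blockDiagonal' fun k => (q.1 k).1) 0 0
      (Matrix.blockDiagonal' fun l => complexToReal (mm l) (q.2 l).1) := rfl

lemma blockMatrix_injective : Function.Injective (blockMatrix nn mm) := by
  intro q q' h
  rw [blockMatrix_apply, blockMatrix_apply, Matrix.fromBlocks_inj] at h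
  have h1 := Matrix.blockDiagonal'_injective h.1
  have h2 := Matrix.blockDiagonal'_injective h.2.2.2
  refine Prod.ext (funext fun k => ?_) (funext fun l => ?_)
  · exact Subtype.ext (congrFun h1 k)
  · exact Subtype.ext (complexToReal_injective _ (congrFun h2 l))

/-- The block `[α, β; -β, α]` is multiplication by `α - βi` in the basis `1, i`. Hence 𝔹 is the
image of the complex triangular algebra. -/
lemma mem_KMat_iff {n : ℕ} (h : ∑ k, nn k + 2 * ∑ l, mm l = n) (hnn : ∀ k, 0 < nn k)
    (M : Matrix (Fin n) (Fin n) ℝ) :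
    M ∈ KMat nn mm h ↔ ∃ q, M = Matrix.reindexAlgEquiv ℝ ℝ (blockIndex nn mm h)
      (blockMatrix nn mm q) := by
  constructor
  · rintro ⟨T, B, hT, hB, rfl⟩
    choose C hCS hC0 hCD hC using hB
    choose α β hαβ using hCS
    have hz : ∀ l i j, C l i j = Algebra.leftMulMatrix Complex.basisOneI ⟨α l i j, -β l i j⟩ := by
      intro l i j
      rw [hαβ, Algebra.leftMulMatrix_complex]
      simp
    refine ⟨(fun k => ⟨T k, (hT k).1, fun i j => ?_⟩,
      fun l => ⟨Matrix.of fun i j => ⟨α l i j, -β l i j⟩, fun i j hij => ?_, fun i j => ?_⟩), ?_⟩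
    · obtain ⟨μ, hμ⟩ := (hT k).2
      rw [hμ, hμ]
    · refine Algebra.leftMulMatrix_injective Complex.basisOneI ?_
      rw [Matrix.of_apply, ← hz, hC0 l i j hij, map_zero]
    · refine Algebra.leftMulMatrix_injective Complex.basisOneI ?_
      obtain ⟨D, hD⟩ := hCD l
      rw [Matrix.of_apply, Matrix.of_apply, ← hz, ← hz, hD, hD]
    · rw [Matrix.coe_reindexAlgEquiv, blockMatrix_apply]
      congr 3
      funext l
      rw [hC]
      ext x y
      rw [complexToReal_apply]
      simp only [Matrix.of_apply, hz]
  · rintro ⟨q, rfl⟩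
    refine ⟨fun k => (q.1 k).1, fun l => complexToReal (mm l) (q.2 l).1, fun k => ?_, fun l => ?_,
      rfl⟩
    · exact ⟨(q.1 k).2.1, (q.1 k).1 ⟨0, hnn k⟩ ⟨0, hnn k⟩, fun i => (q.1 k).2.2 _ _⟩
    · refine ⟨fun i j => Algebra.leftMulMatrix Complex.basisOneI ((q.2 l).1 i j), fun i j =>
        ⟨((q.2 l).1 i j).re, -((q.2 l).1 i j).im, ?_⟩, fun i j hij => ?_, ?_, rfl⟩
      · refine (Algebra.leftMulMatrix_complex _).trans ?_
        simp
      · exact (congrArg _ ((q.2 l).2.1 i j hij)).trans (map_zero _)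
      · rcases isEmpty_or_nonempty (Fin (mm l)) with hE | ⟨⟨i₀⟩⟩
        · exact ⟨0, fun i => isEmptyElim i⟩
        · exact ⟨_, fun i => congrArg _ ((q.2 l).2.2 i i₀)⟩

lemma blockDiagonal'_mulVec_apply {o : Type*} [Fintype o] [DecidableEq o] {m' : o → Type*}
    [∀ i, Fintype (m' i)] (M : ∀ i, Matrix (m' i) (m' i) ℝ) (v : (Σ i, m' i) → ℝ) (k : o)
    (i : m' k) :
    (Matrix.blockDiagonal' M).mulVec v ⟨k, i⟩ = (M k).mulVec (fun j => v ⟨k, j⟩) i := by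
  rw [Matrix.mulVec, dotProduct, Fintype.sum_sigma, Finset.sum_eq_single k]
  · simp [Matrix.mulVec, dotProduct, Matrix.blockDiagonal'_apply_eq]
  · intro k' _ hk'
    exact Finset.sum_eq_zero fun j _ => by
      rw [Matrix.blockDiagonal'_apply_ne _ _ _ hk'.symm, zero_mul]
  · simp

variable (nn mm) in
/-- The sum of the first basis vectors of all blocks. -/
def firstVec : (Σ k, Fin (nn k)) ⊕ (Σ l, Fin (mm l) × Fin 2) → ℝ :=
  Sum.elim (fun x => if (x.2 : ℕ) = 0 then 1 else 0)
    fun x => if (x.2.1 : ℕ) = 0 ∧ x.2.2 = 0 then 1 else 0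

/-- The elements of the block algebra with Toeplitz blocks. -/
def toeplitzAlg (nn : Fin r → ℕ) (mm : Fin s → ℕ) : Subalgebra ℝ (BlockAlg nn mm) where
  carrier := {q | (∀ k, q.1 k ∈ Algebra.adjoin ℝ {triShift ℝ (nn k)}) ∧
    ∀ l, q.2 l ∈ Algebra.adjoin ℂ {triShift ℂ (mm l)}}
  mul_mem' := fun ⟨h1, h2⟩ ⟨h3, h4⟩ => ⟨fun k => mul_mem (h1 k) (h3 k), fun l =>
    mul_mem (h2 l) (h4 l)⟩
  add_mem' := fun ⟨h1, h2⟩ ⟨h3, h4⟩ => ⟨fun k => add_mem (h1 k) (h3 k), fun l =>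
    add_mem (h2 l) (h4 l)⟩
  algebraMap_mem' c := ⟨fun k => Subalgebra.algebraMap_mem _ c, fun l => by
    have := IsScalarTower.algebraMap_apply ℝ ℂ (triAlgebra ℂ (mm l)) c
    change algebraMap ℝ (triAlgebra ℂ (mm l)) c ∈ _
    rw [this]
    exact Subalgebra.algebraMap_mem _ _⟩

instance : IsMulCommutative (toeplitzAlg nn mm) := by
  have h : ∀ {𝕜 : Type} [Field 𝕜] {m : ℕ} {a b : triAlgebra 𝕜 m},
      a ∈ Algebra.adjoin 𝕜 {triShift 𝕜 m} → b ∈ Algebra.adjoin 𝕜 {triShift 𝕜 m} →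
      a * b = b * a := fun {𝕜 _ m a b} ha hb =>
    congrArg Subtype.val (mul_comm' (⟨a, ha⟩ : Algebra.adjoin 𝕜 {triShift 𝕜 m}) ⟨b, hb⟩)
  exact ⟨⟨fun a b => Subtype.ext (Prod.ext (funext fun k => h (a.2.1 k) (b.2.1 k))
    (funext fun l => h (a.2.2 l) (b.2.2 l)))⟩⟩

/-- `firstVec` reads off the first column of each block; a complex entry supplies two real
coordinates. -/
lemma exists_toeplitz_mulVec_eq (hnn : ∀ k, 0 < nn k) (hmm : ∀ l, 0 < mm l)
    (w : (Σ k, Fin (nn k)) ⊕ (Σ l, Fin (mm l) × Fin 2) → ℝ) :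
    ∃ q ∈ toeplitzAlg nn mm, (blockMatrix nn mm q).mulVec (firstVec nn mm) = w := by
  choose a ha haw using fun k =>
    exists_mem_adjoin_triShift (hnn k) (fun i => w (.inl ⟨k, i⟩))
  choose c hc hcw using fun l =>
    exists_mem_adjoin_triShift (hmm l)
      (fun i => (⟨w (.inr ⟨l, i, 0⟩), w (.inr ⟨l, i, 1⟩)⟩ : ℂ))
  refine ⟨(a, c), ⟨ha, hc⟩, ?_⟩
  rw [blockMatrix_apply, Matrix.fromBlocks_mulVec]
  funext x
  rcases x with ⟨k, i⟩ | ⟨l, i, e⟩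
  · simp only [Sum.elim_inl, Matrix.zero_mulVec, add_zero]
    rw [blockDiagonal'_mulVec_apply, ← haw, Matrix.mulVec, dotProduct,
      Finset.sum_eq_single ⟨0, hnn k⟩]
    · simp [firstVec]
    · intro j _ hj
      have : (j : ℕ) ≠ 0 := fun h => hj (Fin.ext h)
      simp [firstVec, this]
    · simp
  · simp only [Sum.elim_inr, Matrix.zero_mulVec, zero_add]
    rw [blockDiagonal'_mulVec_apply, Matrix.mulVec, dotProduct,
      Finset.sum_eq_single (⟨0, hmm l⟩, 0)]
    · rw [complexToReal_apply, hcw, Algebra.leftMulMatrix_complex]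
      fin_cases e <;> simp [firstVec]
    · rintro ⟨j, f⟩ _ hj
      have : ¬ ((j : ℕ) = 0 ∧ f = 0) := fun h => hj (Prod.ext (Fin.ext h.1) h.2)
      simp [firstVec, this]
    · simp

end BlockAlgebra

/-! ### Commutative algebras with a cyclic vector. -/

section CyclicVector

variable {Q : Type*} [Ring Q] [Algebra ℝ Q] {n r s N : ℕ}

/-- Evaluation of a matrix representation at a vector. -/
def evalAt (Φ : Q →ₐ[ℝ] Matrix (Fin n) (Fin n) ℝ) (v : Fin n → ℝ) : Q →ₗ[ℝ] (Fin n → ℝ) where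
  toFun q := (Φ q).mulVec v
  map_add' p q := by rw [map_add, Matrix.add_mulVec]
  map_smul' c q := by rw [map_smul, Matrix.smul_mulVec, RingHom.id_apply]

variable {Φ : Q →ₐ[ℝ] Matrix (Fin n) (Fin n) ℝ} {v : Fin n → ℝ}
  {j : SplitAlg r s →ₐ[ℝ] Q} {χ : Q →ₐ[ℝ] SplitAlg r s}

lemma evalAt_mul (p q : Q) : evalAt Φ v (p * q) = (Φ p).mulVec (evalAt Φ v q) := by
  simp [evalAt, Matrix.mulVec_mulVec]

variable (𝒜 : Subalgebra ℝ Q)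

/-- An element that commutes with a subalgebra with a cyclic vector is determined by its value at
that vector. -/
lemma eq_of_evalAt_eq (hΦ : Function.Injective Φ)
    (hsurj : ∀ w, ∃ a ∈ 𝒜, evalAt Φ v a = w) {p q : Q} (hp : ∀ a ∈ 𝒜, p * a = a * p)
    (hq : ∀ a ∈ 𝒜, q * a = a * q) (h : evalAt Φ v p = evalAt Φ v q) : p = q := by
  -- Every `w` is `a v`, and `p a v = a p v` depends only on `p v`.
  refine hΦ (Matrix.mulVec_injective (funext fun w => ?_))
  obtain ⟨a, ha, rfl⟩ := hsurj w
  rw [← evalAt_mul, ← evalAt_mul, hp a ha, hq a ha, evalAt_mul, evalAt_mul, h]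

variable [IsMulCommutative 𝒜]

/-- The element of `𝒜` with the same value at `v` must equal `p`. This puts the block scalars into
every such `𝒜`. -/
lemma central_mem_of_cyclic (hΦ : Function.Injective Φ)
    (hsurj : ∀ w, ∃ a ∈ 𝒜, evalAt Φ v a = w) {p : Q} (hp : ∀ q, p * q = q * p) : p ∈ 𝒜 := by
  obtain ⟨a, ha, hav⟩ := hsurj (evalAt Φ v p)
  rwa [eq_of_evalAt_eq 𝒜 hΦ hsurj (fun a _ => hp a) (fun b hb => setLike_mul_comm ha hb) hav.symm]

/-- A commutative algebra with a cyclic vector is equivalent to its module. -/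
noncomputable def evalEquiv (hΦ : Function.Injective Φ)
    (hsurj : ∀ w, ∃ a ∈ 𝒜, evalAt Φ v a = w) : 𝒜 ≃ₗ[ℝ] (Fin n → ℝ) :=
  LinearEquiv.ofBijective (evalAt Φ v ∘ₗ 𝒜.val.toLinearMap)
    ⟨fun a b h => Subtype.ext (eq_of_evalAt_eq 𝒜 hΦ hsurj
      (fun _ hc => setLike_mul_comm a.2 hc) (fun _ hc => setLike_mul_comm b.2 hc) h),
    fun w => (hsurj w).elim fun a ha => ⟨⟨a, ha.1⟩, ha.2⟩⟩

variable [TopologicalSpace Q] [IsTopologicalRing Q]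

open scoped IsMulCommutative

lemma Subalgebra.isTopologicalRing_of_isMulCommutative : IsTopologicalRing 𝒜 :=
  { toIsTopologicalSemiring := inferInstance
    continuous_neg := continuous_induced_rng.2 (continuous_subtype_val.neg) }

variable [ContinuousSMul ℝ Q] [T2Space Q] [FiniteDimensional ℝ Q]

/-- Finitely many commuting elements with a dense orbit number more than `n - s`. -/
theorem lt_card_add_of_dense_orbit (hr : 0 < r) (hN : 0 < N) (hΦ : Function.Injective Φ)
    (hcomm : ∀ d q, j d * q = q * j d) (hjχ : ∀ d, χ (j d) = d)
    (hnil : ∀ x, χ x = 0 → x ^ N = 0) (S : Finset Q) (hS : ∀ x ∈ S, ∀ y ∈ S, x * y = y * x)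
    (hdense : Dense (evalAt Φ v '' (Subsemigroup.closure (S : Set Q) : Set Q))) :
    n < S.card + s := by
  classical
  let 𝒜 := Algebra.adjoin ℝ (S : Set Q)
  have : IsMulCommutative 𝒜 := Algebra.isMulCommutative_adjoin ℝ hS
  have hcl : Subsemigroup.closure (S : Set Q) ≤ 𝒜.toSubmonoid.toSubsemigroup :=
    Subsemigroup.closure_le.2 Algebra.subset_adjoin
  have hsurj : ∀ w, ∃ a ∈ 𝒜, evalAt Φ v a = w := by
    -- A subspace is closed, so one that contains a dense orbit is everything.
    let W := (Subalgebra.toSubmodule 𝒜).map (evalAt Φ v)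
    have hW : (W : Set (Fin n → ℝ)) = Set.univ := by
      rw [← (Submodule.closed_of_finiteDimensional W).closure_eq]
      refine (hdense.mono ?_).closure_eq
      rintro _ ⟨a, ha, rfl⟩
      exact ⟨a, hcl ha, rfl⟩
    intro w
    obtain ⟨a, ha, h⟩ := hW.symm.subset (Set.mem_univ w)
    exact ⟨a, ha, h⟩
  let e := evalEquiv 𝒜 hΦ hsurj
  have := Subalgebra.isTopologicalRing_of_isMulCommutative 𝒜
  let ι : SplitAlg r s →ₐ[ℝ] 𝒜 :=
    j.codRestrict 𝒜 fun d => central_mem_of_cyclic 𝒜 hΦ hsurj (hcomm d)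
  let S' : Finset 𝒜 := S.attach.image fun a : {x // x ∈ S} => ⟨a, Algebra.subset_adjoin a.2⟩
  have hS' : S'.card ≤ S.card := Finset.card_image_le.trans S.card_attach.le
  have hmap : ∀ a ∈ Subsemigroup.closure (S : Set Q), ∃ a' ∈ Subsemigroup.closure (S' : Set 𝒜),
      (a' : Q) = a := by
    intro a ha
    induction ha using Subsemigroup.closure_induction with
    | mem x hx =>
      refine ⟨⟨x, Algebra.subset_adjoin hx⟩, Subsemigroup.subset_closure ?_, rfl⟩
      simp only [S', Finset.coe_image, Set.mem_image]
      exact ⟨⟨x, hx⟩, by simp, rfl⟩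
    | mul x y _ _ hx hy =>
      obtain ⟨x', hx', rfl⟩ := hx
      obtain ⟨y', hy', rfl⟩ := hy
      exact ⟨x' * y', mul_mem hx' hy', rfl⟩
  have hd : Dense (Subsemigroup.closure (S' : Set 𝒜) : Set 𝒜) := by
    refine (hdense.preimage e.toContinuousLinearEquiv.toHomeomorph.isOpenMap).mono ?_
    rintro a ⟨b, hb, hba⟩
    obtain ⟨b', hb', rfl⟩ := hmap b hb
    have : b' = a := e.injective hba
    rwa [← this]
  have h := finrank_lt_card_add_of_dense (ι := ι) (χ := χ.comp 𝒜.val) hN hr (fun d => hjχ d)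
    (fun x hx => Subtype.ext (hnil x hx)) S' hd
  rw [e.finrank_eq, Module.finrank_fin_fun] at h
  omega

/-- A commutative subalgebra with a cyclic vector contains a finite set of at most `n - s + 1`
elements with a dense orbit. -/
theorem exists_dense_orbit (hN : 0 < N) (hΦ : Function.Injective Φ)
    (hcomm : ∀ d q, j d * q = q * j d) (hjχ : ∀ d, χ (j d) = d)
    (hnil : ∀ x, χ x = 0 → x ^ N = 0) (hsurj : ∀ w, ∃ a ∈ 𝒜, evalAt Φ v a = w) :
    ∃ S : Finset Q, S.card + s ≤ n + 1 ∧ (S : Set Q) ⊆ 𝒜 ∧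
      Dense (evalAt Φ v '' (Subsemigroup.closure (S : Set Q) : Set Q)) := by
  classical
  let e := evalEquiv 𝒜 hΦ hsurj
  have := Subalgebra.isTopologicalRing_of_isMulCommutative 𝒜
  let ι : SplitAlg r s →ₐ[ℝ] 𝒜 :=
    j.codRestrict 𝒜 fun d => central_mem_of_cyclic 𝒜 hΦ hsurj (hcomm d)
  obtain ⟨S', hS', hd⟩ := exists_dense_closure (ι := ι) (χ := χ.comp 𝒜.val) hN (fun d => hjχ d)
    (fun x hx => Subtype.ext (hnil x hx))
  rw [e.finrank_eq, Module.finrank_fin_fun] at hS'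
  refine ⟨S'.image Subtype.val, ?_, ?_, ?_⟩
  · have : (S'.image Subtype.val).card ≤ S'.card := Finset.card_image_le
    omega
  · intro x hx
    obtain ⟨y, _, rfl⟩ := Finset.mem_image.1 (Finset.mem_coe.1 hx)
    exact y.2
  · refine (e.toContinuousLinearEquiv.surjective.denseRange.dense_image
      e.toContinuousLinearEquiv.continuous hd).mono ?_
    rintro _ ⟨a, ha, rfl⟩
    refine ⟨a, ?_, rfl⟩
    induction ha using Subsemigroup.closure_induction with
    | mem x hx => exact Subsemigroup.subset_closure (by simpa using hx)
    | mul x y _ _ hx hy => exact mul_mem hx hy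

end CyclicVector

/-! ### Transfer to matrices and conclusion. -/

section Main

variable {r s : ℕ} {nn : Fin r → ℕ} {mm : Fin s → ℕ}

instance (m : ℕ) : ContinuousSMul ℝ (triAlgebra ℂ m) :=
  Topology.IsInducing.subtypeVal.continuousSMul continuous_id rfl

instance : IsTopologicalRing (BlockAlg nn mm) where
  continuous_neg := by
    refine (continuous_pi fun k => ?_).prodMk (continuous_pi fun l => ?_)
    · exact continuous_induced_rng.2 (by
        exact (continuous_subtype_val.comp ((continuous_apply k).comp continuous_fst)).neg)
    · exact continuous_induced_rng.2 (by
        exact (continuous_subtype_val.comp ((continuous_apply l).comp continuous_snd)).neg)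

/-- Every commuting finite subset of a conjugate of `𝒦` with a dense orbit has more than `n - s`
elements. -/
lemma lt_card_add_of_isHypercyclicSemigroup {n : ℕ} (hr : 1 ≤ r) (hnn : ∀ k, 0 < nn k)
    (hmm : ∀ l, 0 < mm l) (h : ∑ k, nn k + 2 * ∑ l, mm l = n)
    (S : Finset (Matrix (Fin n) (Fin n) ℝ))
    (hab : IsAbelianSemigroup (Subsemigroup.closure (S : Set (Matrix (Fin n) (Fin n) ℝ))))
    (hnf : HasNormalFormIn (Subsemigroup.closure (S : Set (Matrix (Fin n) (Fin n) ℝ)))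
      (KMat nn mm h))
    (hhc : IsHypercyclicSemigroup (Subsemigroup.closure (S : Set (Matrix (Fin n) (Fin n) ℝ)))) :
    n < S.card + s := by
  classical
  obtain ⟨P, hP⟩ := hnf
  obtain ⟨v, hv⟩ := hhc
  let Φ₀ : BlockAlg nn mm →ₐ[ℝ] Matrix (Fin n) (Fin n) ℝ :=
    (Matrix.reindexAlgEquiv ℝ ℝ (blockIndex nn mm h)).toAlgHom.comp (blockMatrix nn mm)
  -- Conjugating the representation, not the matrices, keeps the vector `v` and its orbit unchanged.
  let Φ : BlockAlg nn mm →ₐ[ℝ] Matrix (Fin n) (Fin n) ℝ :=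
    AlgHom.ofLinearMap (LinearMap.mulLeftRight ℝ (P.1, P⁻¹.1) ∘ₗ Φ₀.toLinearMap)
      (by simp) (fun p q => by
        have := P.inv_mul
        simp only [LinearMap.comp_apply, LinearMap.mulLeftRight_apply, AlgHom.toLinearMap_apply,
          map_mul, mul_assoc]
        rw [← mul_assoc (P⁻¹.1) P.1, this, one_mul])
  have hΦa : ∀ q, Φ q = P.1 * Φ₀ q * P⁻¹.1 := fun q => rfl
  have hΦ₀ : Function.Injective Φ₀ :=
    (Matrix.reindexAlgEquiv ℝ ℝ (blockIndex nn mm h)).injective.comp blockMatrix_injective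
  have hback : ∀ q, P⁻¹.1 * Φ q * P.1 = Φ₀ q := fun q => by
    rw [hΦa]
    simp only [mul_assoc]
    rw [P.inv_mul, mul_one, ← mul_assoc, P.inv_mul, one_mul]
  have hΦ : Function.Injective Φ := fun p q hpq => hΦ₀ (by rw [← hback, hpq, hback])
  have hlift : ∀ A ∈ S, ∃ q, Φ q = A := fun A hA => by
    obtain ⟨q, hq⟩ := (mem_KMat_iff h hnn _).1 (hP A (Subsemigroup.subset_closure hA))
    refine ⟨q, ?_⟩
    rw [hΦa]
    have : Φ₀ q = P⁻¹.1 * A * P.1 := hq.symm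
    rw [this]
    simp only [mul_assoc]
    rw [P.mul_inv, mul_one, ← mul_assoc, P.mul_inv, one_mul]
  choose! q hq using hlift
  let S' := S.image q
  have hS' : S'.card ≤ S.card := Finset.card_image_le
  have hdense : Dense (evalAt Φ v '' (Subsemigroup.closure (S' : Set (BlockAlg nn mm)) :
      Set (BlockAlg nn mm))) := by
    refine hv.mono ?_
    rintro _ ⟨A, hA, rfl⟩
    have : ∃ a ∈ Subsemigroup.closure (S' : Set (BlockAlg nn mm)), Φ a = A := by
      induction hA using Subsemigroup.closure_induction with
      | mem x hx => exact ⟨q x, Subsemigroup.subset_closure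
          (Finset.mem_coe.2 (Finset.mem_image_of_mem q hx)), hq x hx⟩
      | mul x y _ _ hx hy =>
        obtain ⟨a, ha, rfl⟩ := hx
        obtain ⟨b, hb, rfl⟩ := hy
        exact ⟨a * b, mul_mem ha hb, map_mul Φ a b⟩
    obtain ⟨a, ha, rfl⟩ := this
    exact ⟨a, ha, rfl⟩
  refine lt_of_lt_of_le (lt_card_add_of_dense_orbit (j := blockScalar nn mm)
    (χ := blockDiag hnn hmm) hr (Nat.succ_pos _) hΦ blockScalar_comm
    (blockDiag_blockScalar hnn hmm) (fun x hx => blockAlg_pow_eq_zero hnn hmm hx) S' ?_ hdense)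
    (by omega)
  intro x hx y hy
  obtain ⟨A, hA, rfl⟩ := Finset.mem_image.1 hx
  obtain ⟨B, hB, rfl⟩ := Finset.mem_image.1 hy
  refine hΦ ?_
  rw [map_mul, map_mul, hq A hA, hq B hB]
  exact hab A (Subsemigroup.subset_closure hA) B (Subsemigroup.subset_closure hB)

/-- Some set of at most `n - s + 1` matrices generates a hypercyclic abelian subsemigroup
of `𝒦`. -/
lemma exists_isHypercyclicSemigroup {n : ℕ} (hnn : ∀ k, 0 < nn k)
    (hmm : ∀ l, 0 < mm l) (h : ∑ k, nn k + 2 * ∑ l, mm l = n) :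
    ∃ S : Finset (Matrix (Fin n) (Fin n) ℝ), S.card + s ≤ n + 1 ∧
      IsAbelianSemigroup (Subsemigroup.closure (S : Set (Matrix (Fin n) (Fin n) ℝ))) ∧
      HasNormalFormIn (Subsemigroup.closure (S : Set (Matrix (Fin n) (Fin n) ℝ)))
        (KMat nn mm h) ∧
      IsHypercyclicSemigroup (Subsemigroup.closure (S : Set (Matrix (Fin n) (Fin n) ℝ))) := by
  classical
  let Φ : BlockAlg nn mm →ₐ[ℝ] Matrix (Fin n) (Fin n) ℝ :=
    (Matrix.reindexAlgEquiv ℝ ℝ (blockIndex nn mm h)).toAlgHom.comp (blockMatrix nn mm)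
  have hΦ : Function.Injective Φ :=
    (Matrix.reindexAlgEquiv ℝ ℝ (blockIndex nn mm h)).injective.comp blockMatrix_injective
  let v : Fin n → ℝ := firstVec nn mm ∘ (blockIndex nn mm h).symm
  have hsurj : ∀ w, ∃ a ∈ toeplitzAlg nn mm, evalAt Φ v a = w := fun w => by
    obtain ⟨a, ha, haw⟩ := exists_toeplitz_mulVec_eq hnn hmm (w ∘ blockIndex nn mm h)
    refine ⟨a, ha, ?_⟩
    change (Matrix.reindex (blockIndex nn mm h) (blockIndex nn mm h)
      (blockMatrix nn mm a)).mulVec v = w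
    rw [Matrix.reindex_apply, Matrix.submatrix_mulVec_equiv]
    simp only [v, Function.comp_assoc, Equiv.symm_comp_self, Function.comp_id, Equiv.symm_symm,
      haw, Equiv.self_comp_symm]
  obtain ⟨S, hcard, hsub, hd⟩ := exists_dense_orbit (j := blockScalar nn mm)
    (χ := blockDiag hnn hmm) (toeplitzAlg nn mm) (Nat.succ_pos _) hΦ blockScalar_comm
    (blockDiag_blockScalar hnn hmm) (fun x hx => blockAlg_pow_eq_zero hnn hmm hx) hsurj
  have hcl : Subsemigroup.closure (S : Set (BlockAlg nn mm)) ≤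
      (toeplitzAlg nn mm).toSubmonoid.toSubsemigroup := Subsemigroup.closure_le.2 hsub
  have hmap : Subsemigroup.closure ((S.image Φ : Finset _) : Set (Matrix (Fin n) (Fin n) ℝ)) =
      (Subsemigroup.closure (S : Set (BlockAlg nn mm))).map (Φ : BlockAlg nn mm →ₙ* _) := by
    rw [MulHom.map_mclosure, Finset.coe_image]
    rfl
  refine ⟨S.image Φ, ?_, ?_, ?_, ?_⟩
  · have : (S.image Φ).card ≤ S.card := Finset.card_image_le
    omega
  · rw [hmap]
    rintro _ ⟨a, ha, rfl⟩ _ ⟨b, hb, rfl⟩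
    change Φ a * Φ b = Φ b * Φ a
    rw [← map_mul, ← map_mul, setLike_mul_comm (s := toeplitzAlg nn mm) (hcl ha) (hcl hb)]
  · rw [hmap]
    refine ⟨1, ?_⟩
    rintro _ ⟨a, _, rfl⟩
    rw [inv_one, Units.val_one, one_mul, mul_one]
    exact (mem_KMat_iff h hnn _).2 ⟨a, rfl⟩
  · rw [hmap]
    refine ⟨v, hd.mono ?_⟩
    rintro _ ⟨a, ha, rfl⟩
    exact ⟨Φ a, ⟨a, ha, rfl⟩, rfl⟩

end Main

theorem corollary1p8 (n r s : ℕ) (hr : 1 ≤ r) (nn : Fin r → ℕ) (mm : Fin s → ℕ)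
    (hnn : ∀ k, 0 < nn k) (hmm : ∀ l, 0 < mm l)
    (h : ∑ k, nn k + 2 * ∑ l, mm l = n) :
    IsLeast
      {p : ℕ | ∃ S : Finset (Matrix (Fin n) (Fin n) ℝ), S.card = p ∧
        IsAbelianSemigroup (Subsemigroup.closure (S : Set (Matrix (Fin n) (Fin n) ℝ))) ∧
        HasNormalFormIn (Subsemigroup.closure (S : Set (Matrix (Fin n) (Fin n) ℝ)))
          (KMat nn mm h) ∧
        IsHypercyclicSemigroup (Subsemigroup.closure (S : Set (Matrix (Fin n) (Fin n) ℝ)))}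
      (n - s + 1) := by
  -- Needed because `n - s` is truncated subtraction.
  have hs : s ≤ n := by
    have : s ≤ ∑ l, mm l := by
      simpa using Finset.sum_le_sum (s := Finset.univ) (f := fun _ : Fin s => 1) (g := mm)
        fun l _ => hmm l
    omega
  constructor
  · obtain ⟨S, hcard, hab, hnf, hhc⟩ := exists_isHypercyclicSemigroup hnn hmm h
    -- The construction only bounds the cardinality from above, as generators might coincide; the
    -- lower bound makes it exact.
    have := lt_card_add_of_isHypercyclicSemigroup hr hnn hmm h S hab hnf hhc
    exact ⟨S, by omega, hab, hnf, hhc⟩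
  · rintro _ ⟨S, rfl, hab, hnf, hhc⟩
    have := lt_card_add_of_isHypercyclicSemigroup hr hnn hmm h S hab hnf hhc
    omega
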